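/- Let $D>0$ and let $\omega\in C^1[0,D]$ be real-valued with $\min_{x\in[0,D]}\omega(x)>0$. Let $\lambda_1(\omega)>0$ denote the first nontrivial eigenvalue, i.e. the least positive $\lambda$ admitting a nonzero solution $u$, of the Neumann problem $$-(\omega u')'=\lambda\,\omega\,u \ \text{ on } (0,D),\qquad u'(0)=u'(D)=0 .$$ A metric graph is a connected graph with finitely many vertices and finitely many edges, each edge $e$ being identified with an interval $[0,|e|]$ of finite length $|e|>0$ (parallel edges are allowed). Its diameter is $D(G)=\sup\{\operatorname{dist}(x,y): x,y\in G\}$, where the supremum is over all points (not only vertices) and $\operatorname{dist}$ is the shortest-path distance. Its spectral gap $\lambda_1(G)$ is the least positive eigenvalue of the Laplacian $-u''$ on the edges with natural vertex conditions: $u$ is continuous at the vertices, and at each vertex the outgoing derivatives along all incident edge ends sum to zero. A pumpkin chain is a loopless metric graph in which exactly two vertices are adjacent to exactly one other vertex, all the remaining vertices are adjacent to exactly two other vertices, and any two edges joining the same pair of vertices have the same length. Then both kinds of first nontrivial eigenvalue exist for the objects below, and there is a sequence $(G_n)_{n\in\mathbb N}$ of pumpkin chains with $D(G_n)=D$ for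 every $n$ and $$\lim_{n\to\infty}\lambda_1(G_n)=\lambda_1(\omega).$$ -/

import Mathlib

open Set Filter Topology

noncomputable section

/-- A connected compact finite metric graph: finitely many vertices and edges, multiple edges and
loops allowed. The edge `e` is a copy of the interval `[0, len e]` of positive finite length, whose
endpoints `0` and `len e` are attached to the vertices `src e` and `tgt e`. -/
structure MetricGraph where
  V : Type
  E : Type
  [fintypeV : Fintype V]
  [fintypeE : Fintype E]
  src : E → V
  tgt : E → V
  len : E → ℝ
  len_pos : ∀ e, 0 < len e
  connected : (SimpleGraph.fromRel fun v w => ∃ e, src e = v ∧ tgt e = w).Connected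

namespace MetricGraph

attribute [instance] MetricGraph.fintypeV MetricGraph.fintypeE

variable (G : MetricGraph)

/-- Adjacency of distinct vertices: `v ≠ w` and some edge connects `v` and `w`. -/
def adjacency : SimpleGraph G.V :=
  SimpleGraph.fromRel fun v w => ∃ e, G.src e = v ∧ G.tgt e = w

/-- The identification of the endpoints of the edge intervals with the vertices. -/
inductive Glue : G.V ⊕ (Σ e : G.E, Icc (0 : ℝ) (G.len e)) →
    G.V ⊕ (Σ e : G.E, Icc (0 : ℝ) (G.len e)) → Prop
  | src (e : G.E) :
      Glue (Sum.inl (G.src e)) (Sum.inr ⟨e, ⟨0, le_refl 0, (G.len_pos e).le⟩⟩)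
  | tgt (e : G.E) :
      Glue (Sum.inl (G.tgt e)) (Sum.inr ⟨e, ⟨G.len e, (G.len_pos e).le, le_refl (G.len e)⟩⟩)

/-- The points of the metric graph: the vertices and the points of the edge intervals,
the endpoints of the intervals being identified with the vertices. -/
def Point : Type := Quot G.Glue

/-- The vertex `v` as a point of the metric graph. -/
def vertexPoint (v : G.V) : G.Point := Quot.mk _ (Sum.inl v)

/-- The point at coordinate `s` on the edge `e`. -/
def edgePoint (e : G.E) (s : Icc (0 : ℝ) (G.len e)) : G.Point := Quot.mk _ (Sum.inr ⟨e, s⟩)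

/-- `G.PathOfLength x y L`: there is a path of length `L` in the metric graph from `x` to `y`,
i.e. a finite concatenation of segments, each inside one edge. -/
inductive PathOfLength : G.Point → G.Point → ℝ → Prop
  | refl (x : G.Point) : PathOfLength x x 0
  | segment (e : G.E) (s t : Icc (0 : ℝ) (G.len e)) :
      PathOfLength (G.edgePoint e s) (G.edgePoint e t) |(s : ℝ) - t|
  | concat {x y z : G.Point} {a b : ℝ} :
      PathOfLength x y a → PathOfLength y z b → PathOfLength x z (a + b)

/-- The distance of two points: the length of a shortest path connecting them. -/
def dist (x y : G.Point) : ℝ := sInf {L | G.PathOfLength x y L}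

/-- The diameter: the supremum of the distances between any two points (not only vertices). -/
def diam : ℝ := sSup {d | ∃ x y : G.Point, d = G.dist x y}

/-- `G` is a pumpkin chain: there are no loops, all but two of the vertices are adjacent to exactly
two other vertices, the remaining two vertices are adjacent to exactly one other vertex, and
parallel edges have the same length. -/
structure IsPumpkinChain : Prop where
  loopless : ∀ e, G.src e ≠ G.tgt e
  interior : {v : G.V | (G.adjacency.neighborSet v).ncard = 2}.ncard + 2 = Fintype.card G.V
  ends : {v : G.V | (G.adjacency.neighborSet v).ncard = 1}.ncard = 2
  parallel : ∀ e f, s(G.src e, G.tgt e) = s(G.src f, G.tgt f) → G.len e = G.len f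

open Classical in
/-- `u` is an eigenfunction, with eigenvalue `μ`, of the (negative) Laplacian of the metric graph
with natural vertex conditions. Here `u e` is the restriction of the function to the edge `e`, only
its values on `[0, len e]` matter, and `u' e` is its derivative along `e`. The function is
nonzero, is `C¹` on every closed edge and satisfies `-u'' = μ u` inside; it is continuous at the
vertices, with value `c v` at `v`, and its derivatives at each vertex, taken in the direction away
from the vertex along all edge ends attached to it, add up to zero. -/
structure IsEigenfunction (μ : ℝ) (u : G.E → ℝ → ℝ) (u' : G.E → ℝ → ℝ) (c : G.V → ℝ) : Prop where
  nonzero : ∃ e, ∃ x ∈ Icc 0 (G.len e), u e x ≠ 0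
  deriv : ∀ e, ∀ x ∈ Icc 0 (G.len e), HasDerivWithinAt (u e) (u' e x) (Icc 0 (G.len e)) x
  deriv_cont : ∀ e, ContinuousOn (u' e) (Icc 0 (G.len e))
  equation : ∀ e, ∀ x ∈ Ioo 0 (G.len e), HasDerivAt (u' e) (-(μ * u e x)) x
  continuous_src : ∀ e, u e 0 = c (G.src e)
  continuous_tgt : ∀ e, u e (G.len e) = c (G.tgt e)
  kirchhoff : ∀ v, ∑ e, ((if G.src e = v then u' e 0 else 0)
    + (if G.tgt e = v then -u' e (G.len e) else 0)) = 0

/-- The set of positive eigenvalues of the Laplacian with natural vertex conditions. -/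
def positiveEigenvalues : Set ℝ := {μ | 0 < μ ∧ ∃ u u' c, G.IsEigenfunction μ u u' c}

/-- The spectral gap `λ₁(G)`: the lowest positive eigenvalue. -/
def spectralGap : ℝ := sInf G.positiveEigenvalues

end MetricGraph

/-- `u` is an eigenfunction, with eigenvalue `μ`, of the Neumann problem
`-(ω u')' = μ ω u` on `(0, D)`, `u'(0) = u'(D) = 0`; here `u'` is the derivative of `u`. -/
structure IsNeumannEigenfunction (D : ℝ) (ω : ℝ → ℝ) (μ : ℝ) (u u' : ℝ → ℝ) : Prop where
  nonzero : ∃ x ∈ Icc 0 D, u x ≠ 0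
  deriv : ∀ x ∈ Icc 0 D, HasDerivWithinAt u (u' x) (Icc 0 D) x
  deriv_cont : ContinuousOn u' (Icc 0 D)
  equation : ∀ x ∈ Ioo 0 D, HasDerivAt (fun y => ω y * u' y) (-(μ * ω x * u x)) x
  left : u' 0 = 0
  right : u' D = 0

/-- The set of positive Neumann eigenvalues of the weight `ω` on `(0, D)`. -/
def positiveNeumannEigenvalues (D : ℝ) (ω : ℝ → ℝ) : Set ℝ :=
  {μ | 0 < μ ∧ ∃ u u', IsNeumannEigenfunction D ω μ u u'}

/-- The first nontrivial Neumann eigenvalue `λ₁(ω)`: the lowest positive one. -/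
def firstNeumannEigenvalue (D : ℝ) (ω : ℝ → ℝ) : ℝ := sInf (positiveNeumannEigenvalues D ω)

end

/-! On a pumpkin chain whose pumpkins all have length D/k, a function that agrees on parallel edges
is a function of the position x in [0, D] alone. For such functions the vertex conditions say
exactly that u solves the Neumann problem -(w u')' = μ w u, where w(x) is the number of edges over
x. If an eigenfunction differs on two parallel edges, the difference is a Dirichlet eigenfunction on
an interval of length D/k, so its eigenvalue is at least (πk/D)². Hence for large k the spectral gap
of the chain is λ₁(w) (`MetricGraph.pumpkinChain_spectralGap`). Scaling a weight does not change its
eigenvalues, so it suffices that integer step weights approximate Nω, for large N, with small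
relative error (`exists_chainWeight_approx`).

What remains is stability of λ₁: if κ w ≤ w₂ ≤ ρ w, then λ₁(w₂) ≤ (ρ/κ) λ₁(w)
(`sInf_weightEigenvalues_le`). Instead of a variational principle, the proof uses shooting. The
system Z' = w u, u' = -μ Z/w, u(0) = 1, Z(0) = 0 for u and its rescaled flux Z = -w u'/μ is solved
by power series in μ, jointly continuous in μ and x, and μ > 0 is an eigenvalue iff Z(D) = 0.
Picone's identity for fluxes shows that for Λ > (ρ/κ) λ₁(w) the flux of w₂ is nonpositive somewhere
on (0, D] (`IsSol.picone_comparison`). At the smallest parameter where this happens, the zero must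
lie at D, which gives an eigenvalue at most Λ (`exists_weightEigenvalue_le`). Right-continuity and
one-sided derivatives suffice throughout, so continuous weights and step weights are treated
together. -/

/-! ### Weights and their integral operators -/

/-- A weight: a measurable, right-continuous function on the line, bounded above and bounded
below by a positive constant. -/
structure IsWeight (w : ℝ → ℝ) : Prop where
  measurable : Measurable w
  right_cont : ∀ x, ContinuousWithinAt w (Ici x) x
  lower : ∃ m, 0 < m ∧ ∀ x, m ≤ w x
  upper : ∃ M, ∀ x, w x ≤ M

namespace IsWeight

variable {w : ℝ → ℝ}

theorem pos (hw : IsWeight w) (x : ℝ) : 0 < w x := by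
  obtain ⟨m, hm, h⟩ := hw.lower
  exact hm.trans_le (h x)

theorem inv (hw : IsWeight w) : IsWeight (fun x => (w x)⁻¹) where
  measurable := hw.measurable.inv
  right_cont x := (hw.right_cont x).inv₀ (hw.pos x).ne'
  lower := by
    obtain ⟨M, h⟩ := hw.upper
    exact ⟨M⁻¹, inv_pos.2 ((hw.pos 0).trans_le (h 0)), fun x => inv_anti₀ (hw.pos x) (h x)⟩
  upper := by
    obtain ⟨m, hm, h⟩ := hw.lower
    exact ⟨m⁻¹, fun x => inv_anti₀ hm (h x)⟩

theorem exists_bound (hw : IsWeight w) : ∃ K, 0 < K ∧ ∀ x, w x ≤ K ∧ (w x)⁻¹ ≤ K := by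
  obtain ⟨M, h⟩ := hw.upper
  obtain ⟨M', h'⟩ := hw.inv.upper
  exact ⟨max M M', (hw.pos 0).trans_le ((h 0).trans (le_max_left _ _)),
    fun x => ⟨(h x).trans (le_max_left _ _), (h' x).trans (le_max_right _ _)⟩⟩

theorem intervalIntegrable_mul (hw : IsWeight w) {g : ℝ → ℝ} (hg : Continuous g) (a b : ℝ) :
    IntervalIntegrable (fun t => w t * g t) MeasureTheory.volume a b := by
  obtain ⟨M, hM⟩ := hw.upper
  have hgi := hg.intervalIntegrable (μ := MeasureTheory.volume) a b
  have key : ∀ x, ‖w x‖ ≤ M := fun x => by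
    rw [Real.norm_of_nonneg (hw.pos x).le]; exact hM x
  exact ⟨hgi.1.bdd_mul hw.measurable.aestronglyMeasurable (Eventually.of_forall key),
    hgi.2.bdd_mul hw.measurable.aestronglyMeasurable (Eventually.of_forall key)⟩

end IsWeight

/-- The integral operator `f ↦ ∫₀ˣ φ f`. -/
noncomputable def volterra (φ f : ℝ → ℝ) (x : ℝ) : ℝ := ∫ t in (0 : ℝ)..x, φ t * f t

theorem IsWeight.continuous_volterra {w g : ℝ → ℝ} (hw : IsWeight w) (hg : Continuous g) :
    Continuous (volterra w g) :=
  intervalIntegral.continuous_primitive (fun a b => hw.intervalIntegrable_mul hg a b) 0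

theorem IsWeight.hasDerivWithinAt_volterra {w g : ℝ → ℝ} (hw : IsWeight w) (hg : Continuous g)
    (x : ℝ) : HasDerivWithinAt (volterra w g) (w x * g x) (Ici x) x := by
  refine intervalIntegral.integral_hasDerivWithinAt_right (hw.intervalIntegrable_mul hg 0 x) ?_ ?_
  · exact (hw.measurable.mul hg.measurable).stronglyMeasurable.stronglyMeasurableAtFilter
  · exact ((hw.right_cont x).mul hg.continuousWithinAt).mono Ioi_subset_Ici_self

theorem IsWeight.hasDerivAt_volterra {w g : ℝ → ℝ} (hw : IsWeight w) (hg : Continuous g)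
    {x : ℝ} (hx : ContinuousAt w x) : HasDerivAt (volterra w g) (w x * g x) x := by
  refine intervalIntegral.integral_hasDerivAt_right (hw.intervalIntegrable_mul hg 0 x) ?_ ?_
  · exact (hw.measurable.mul hg.measurable).stronglyMeasurable.stronglyMeasurableAtFilter
  · exact hx.mul hg.continuousAt

theorem IsWeight.abs_volterra_le {w g B : ℝ → ℝ} (hw : IsWeight w) {K : ℝ}
    (hK : ∀ x, w x ≤ K) (hB : Continuous B) {x : ℝ} (hx : 0 ≤ x)
    (h : ∀ t ∈ Icc 0 x, |g t| ≤ B t) : |volterra w g x| ≤ K * ∫ t in (0 : ℝ)..x, B t := by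
  rw [← intervalIntegral.integral_const_mul, ← Real.norm_eq_abs, volterra]
  have hi : IntervalIntegrable (fun t => K * B t) MeasureTheory.volume 0 x :=
    (continuous_const.mul hB).intervalIntegrable _ _
  refine intervalIntegral.norm_integral_le_of_norm_le hx (Eventually.of_forall fun t ht => ?_) hi
  rw [norm_mul, Real.norm_of_nonneg (hw.pos t).le]
  exact mul_le_mul (hK t) (h t (Ioc_subset_Icc_self ht)) (abs_nonneg _) ((hw.pos t).le.trans (hK t))

/-! ### The shooting solution as a power series in the spectral parameter -/

/-- Clamping to the interval `[0, D]`. -/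
noncomputable def clamp (D x : ℝ) : ℝ := max 0 (min D x)

theorem continuous_clamp (D : ℝ) : Continuous (clamp D) := by unfold clamp; fun_prop

theorem clamp_mem {D : ℝ} (hD : 0 ≤ D) (x : ℝ) : clamp D x ∈ Icc 0 D :=
  ⟨le_max_left _ _, max_le hD (min_le_left _ _)⟩

theorem clamp_of_mem {D x : ℝ} (hx : x ∈ Icc 0 D) : clamp D x = x := by
  rw [clamp, min_eq_right hx.2, max_eq_right hx.1]

/-- The power series in `-μ` with coefficient functions `g k`, extended constantly
outside of `[0, D]`. -/
noncomputable def coeffSeries (D : ℝ) (g : ℕ → ℝ → ℝ) (μ x : ℝ) : ℝ :=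
  ∑' k, (-μ) ^ k * g k (clamp D x)

section Series

variable {D A R : ℝ} {g : ℕ → ℝ → ℝ}

theorem abs_pow_mul_coeff_le
    (hg : ∀ k, ∀ x ∈ Icc 0 D, |g k x| ≤ A * (R ^ k / k.factorial)) {Λ μ : ℝ}
    (hμ : |μ| ≤ Λ) (k : ℕ) {x : ℝ} (hx : x ∈ Icc 0 D) :
    |(-μ) ^ k * g k x| ≤ A * ((Λ * R) ^ k / k.factorial) := by
  rw [abs_mul, abs_pow, abs_neg]
  calc |μ| ^ k * |g k x| ≤ Λ ^ k * (A * (R ^ k / k.factorial)) :=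
        mul_le_mul (pow_le_pow_left₀ (abs_nonneg _) hμ k) (hg k x hx) (abs_nonneg _)
          (pow_nonneg ((abs_nonneg _).trans hμ) _)
    _ = _ := by rw [mul_pow]; ring

theorem summable_coeff_bound (A x : ℝ) : Summable fun k : ℕ => A * (x ^ k / k.factorial) :=
  (Real.summable_pow_div_factorial x).mul_left A

theorem summable_coeff
    (hg : ∀ k, ∀ x ∈ Icc 0 D, |g k x| ≤ A * (R ^ k / k.factorial)) (μ : ℝ) {x : ℝ}
    (hx : x ∈ Icc 0 D) : Summable fun k => (-μ) ^ k * g k x :=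
  Summable.of_norm_bounded (summable_coeff_bound A (|μ| * R))
    fun k => abs_pow_mul_coeff_le hg le_rfl k hx

theorem continuous_coeffSeries (hD : 0 ≤ D) (hc : ∀ k, Continuous (g k))
    (hg : ∀ k, ∀ x ∈ Icc 0 D, |g k x| ≤ A * (R ^ k / k.factorial)) :
    Continuous fun q : ℝ × ℝ => coeffSeries D g q.1 q.2 := by
  refine continuous_iff_continuousAt.2 fun q => ?_
  have hs : {p : ℝ × ℝ | |p.1| < |q.1| + 1} ∈ 𝓝 q :=
    (isOpen_lt (by fun_prop) continuous_const).mem_nhds (by simp)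
  refine ContinuousOn.continuousAt (s := {p : ℝ × ℝ | |p.1| < |q.1| + 1}) ?_ hs
  refine continuousOn_tsum (u := fun k : ℕ => A * (((|q.1| + 1) * R) ^ k / k.factorial))
    (fun k => ?_) (summable_coeff_bound _ _)
    (fun k p hp => abs_pow_mul_coeff_le hg (le_of_lt hp) k (clamp_mem hD _))
  have := (hc k).comp ((continuous_clamp D).comp (continuous_snd (X := ℝ) (Y := ℝ)))
  exact ((continuous_fst.neg.pow k).mul this).continuousOn

theorem IsWeight.volterra_coeffSeries {φ : ℝ → ℝ} (hφ : IsWeight φ)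
    (hc : ∀ k, Continuous (g k))
    (hg : ∀ k, ∀ x ∈ Icc 0 D, |g k x| ≤ A * (R ^ k / k.factorial)) (μ : ℝ) {x : ℝ}
    (hx : x ∈ Icc 0 D) :
    HasSum (fun k => (-μ) ^ k * volterra φ (g k) x) (volterra φ (coeffSeries D g μ) x) := by
  obtain ⟨K, hK0, hK⟩ := hφ.exists_bound
  have hsub : uIoc 0 x ⊆ Icc 0 D := by
    rw [uIoc_of_le hx.1]; exact fun t ht => ⟨ht.1.le, ht.2.trans hx.2⟩
  have := intervalIntegral.hasSum_integral_of_dominated_convergence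
    (μ := MeasureTheory.volume) (a := 0) (b := x)
    (F := fun k t => φ t * ((-μ) ^ k * g k t)) (f := fun t => φ t * coeffSeries D g μ t)
    (fun k _ => K * (A * ((|μ| * R) ^ k / k.factorial)))
    (fun k => (hφ.measurable.mul ((hc k).measurable.const_mul _)).aestronglyMeasurable)
    (fun k => Eventually.of_forall fun t ht => by
      rw [norm_mul, Real.norm_of_nonneg (hφ.pos t).le]
      exact mul_le_mul (hK t).1 (abs_pow_mul_coeff_le hg le_rfl k (hsub ht)) (abs_nonneg _) hK0.le)
    (Eventually.of_forall fun t _ => (summable_coeff_bound _ _).mul_left _)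
    intervalIntegrable_const
    (Eventually.of_forall fun t ht => by
      have := (summable_coeff hg μ (hsub ht)).hasSum.mul_left (φ t)
      simpa only [coeffSeries, clamp_of_mem (hsub ht)] using this)
  have e : ∀ k, (-μ) ^ k * volterra φ (g k) x = ∫ t in (0 : ℝ)..x, φ t * ((-μ) ^ k * g k t) := by
    intro k
    rw [volterra, ← intervalIntegral.integral_const_mul]
    congr 1; ext t; ring
  simp only [e]
  exact this

end Series

/-- The coefficients of the power series in `-μ` of the solution `u` of `(w u')' = -μ w u`,
`u 0 = 1`, `u' 0 = 0`. -/
noncomputable def shootCoeff (w : ℝ → ℝ) : ℕ → ℝ → ℝ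
  | 0 => fun _ => 1
  | k + 1 => volterra (fun x => (w x)⁻¹) (volterra w (shootCoeff w k))

/-- The solution `u` of `(w u')' = -μ w u`, `u 0 = 1`, `u' 0 = 0`. -/
noncomputable def shootU (D : ℝ) (w : ℝ → ℝ) (μ x : ℝ) : ℝ := coeffSeries D (shootCoeff w) μ x

/-- The integral of `w` times the solution `u` of `(w u')' = -μ w u`, `u 0 = 1`, `u' 0 = 0`. -/
noncomputable def shootZ (D : ℝ) (w : ℝ → ℝ) (μ x : ℝ) : ℝ :=
  coeffSeries D (fun k => volterra w (shootCoeff w k)) μ x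

/-- `(u, Z)` solves `Z' = w u`, `u' = -μ Z / w` on `[0, D]` with `Z 0 = 0`, in integrated form. -/
structure IsSol (D : ℝ) (w : ℝ → ℝ) (μ : ℝ) (u Z : ℝ → ℝ) : Prop where
  cont_u : Continuous u
  cont_Z : Continuous Z
  eq_u : ∀ x ∈ Icc 0 D, u x = u 0 - μ * volterra (fun x => (w x)⁻¹) Z x
  eq_Z : ∀ x ∈ Icc 0 D, Z x = volterra w u x

section Shoot

variable {D : ℝ} {w : ℝ → ℝ}

theorem continuous_shootCoeff (hw : IsWeight w) (k : ℕ) : Continuous (shootCoeff w k) := by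
  induction k with
  | zero => exact continuous_const
  | succ k ih => exact hw.inv.continuous_volterra (hw.continuous_volterra ih)

/-- Each coefficient arises from the previous one by two integrations. The inner one is estimated
crudely, at the cost of a factor K D; the outer one is computed exactly and produces the factorial.
-/
theorem abs_shootCoeff_le (hw : IsWeight w) {K : ℝ} (hK0 : 0 < K)
    (hK : ∀ x, w x ≤ K ∧ (w x)⁻¹ ≤ K) (k : ℕ) : ∀ x ∈ Icc 0 D,
    |shootCoeff w k x| ≤ (K * (K * D) * x) ^ k / k.factorial ∧
    |volterra w (shootCoeff w k) x| ≤ K * D * ((K * (K * D) * x) ^ k / k.factorial) := by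
  have step : ∀ k : ℕ, (∀ x ∈ Icc 0 D,
      |shootCoeff w k x| ≤ (K * (K * D) * x) ^ k / k.factorial) → ∀ x ∈ Icc 0 D,
      |volterra w (shootCoeff w k) x| ≤ K * D * ((K * (K * D) * x) ^ k / k.factorial) := by
    intro k h x hx
    have hD : 0 ≤ D := hx.1.trans hx.2
    have h1 := hw.abs_volterra_le (fun x => (hK x).1) (g := shootCoeff w k)
      (B := fun _ => (K * (K * D) * x) ^ k / k.factorial) continuous_const hx.1 (fun t ht => by
        refine (h t ⟨ht.1, ht.2.trans hx.2⟩).trans ?_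
        have := ht.1; have := ht.2
        gcongr)
    rw [intervalIntegral.integral_const, smul_eq_mul, sub_zero] at h1
    have h2 : 0 ≤ (K * (K * D) * x) ^ k / k.factorial := by have := hx.1; positivity
    calc _ ≤ _ := h1
      _ ≤ K * (D * ((K * (K * D) * x) ^ k / k.factorial)) :=
        mul_le_mul_of_nonneg_left (mul_le_mul_of_nonneg_right hx.2 h2) hK0.le
      _ = _ := by ring
  induction k with
  | zero =>
    have h0 : ∀ x ∈ Icc 0 D, |shootCoeff w 0 x| ≤ (K * (K * D) * x) ^ 0 / (0 : ℕ).factorial := by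
      intro x _; simp [shootCoeff]
    exact fun x hx => ⟨h0 x hx, step 0 h0 x hx⟩
  | succ k ih =>
    have h1 : ∀ x ∈ Icc 0 D,
        |shootCoeff w (k + 1) x| ≤ (K * (K * D) * x) ^ (k + 1) / (k + 1).factorial := by
      intro x hx
      have := hw.inv.abs_volterra_le (fun x => (hK x).2) (g := volterra w (shootCoeff w k))
        (B := fun t => K * D * ((K * (K * D) * t) ^ k / k.factorial)) (by fun_prop) hx.1
        (fun t ht => (ih t ⟨ht.1, ht.2.trans hx.2⟩).2)
      refine this.trans_eq ?_
      have e : (fun t : ℝ => K * D * ((K * (K * D) * t) ^ k / k.factorial))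
          = fun t => (K * D * (K * (K * D)) ^ k / k.factorial) * t ^ k := by
        ext t; rw [mul_pow]; ring
      rw [e, intervalIntegral.integral_const_mul, integral_pow, Nat.factorial_succ]
      have h2 : (k.factorial : ℝ) ≠ 0 := by positivity
      push_cast
      field_simp
      ring
    exact fun x hx => ⟨h1 x hx, step _ h1 x hx⟩

theorem exists_shootCoeff_bound (hw : IsWeight w) (hD : 0 ≤ D) : ∃ A R, ∀ k, ∀ x ∈ Icc 0 D,
    |shootCoeff w k x| ≤ A * (R ^ k / k.factorial) ∧
    |volterra w (shootCoeff w k) x| ≤ A * (R ^ k / k.factorial) := by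
  obtain ⟨K, hK0, hK⟩ := hw.exists_bound
  refine ⟨max 1 (K * D), K * (K * D) * D, fun k x hx => ?_⟩
  obtain ⟨h1, h2⟩ := abs_shootCoeff_le (D := D) hw hK0 hK k x hx
  have h3 : (K * (K * D) * x) ^ k / k.factorial ≤ (K * (K * D) * D) ^ k / k.factorial := by
    have := hx.1; have := hx.2
    gcongr
  have h4 : 0 ≤ (K * (K * D) * D) ^ k / k.factorial := by positivity
  constructor
  · refine (h1.trans h3).trans ?_
    exact le_mul_of_one_le_left h4 (le_max_left _ _)
  · refine h2.trans (mul_le_mul (le_max_right _ _) h3 ?_ (by positivity))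
    have := hx.1
    positivity

theorem continuous_shootU (hw : IsWeight w) (hD : 0 ≤ D) :
    Continuous fun q : ℝ × ℝ => shootU D w q.1 q.2 := by
  obtain ⟨A, R, h⟩ := exists_shootCoeff_bound hw hD
  exact continuous_coeffSeries hD (continuous_shootCoeff hw) fun k x hx => (h k x hx).1

theorem continuous_shootZ (hw : IsWeight w) (hD : 0 ≤ D) :
    Continuous fun q : ℝ × ℝ => shootZ D w q.1 q.2 := by
  obtain ⟨A, R, h⟩ := exists_shootCoeff_bound hw hD
  exact continuous_coeffSeries hD
    (fun k => hw.continuous_volterra (continuous_shootCoeff hw k)) fun k x hx => (h k x hx).2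

theorem shootU_zero (hD : 0 ≤ D) (μ : ℝ) : shootU D w μ 0 = 1 := by
  rw [shootU, coeffSeries, tsum_eq_single 0]
  · simp [shootCoeff]
  · intro k hk
    obtain ⟨k, rfl⟩ := Nat.exists_eq_succ_of_ne_zero hk
    rw [clamp_of_mem ⟨le_rfl, hD⟩]
    simp [shootCoeff, volterra]

theorem isSol_shoot (hw : IsWeight w) (hD : 0 ≤ D) (μ : ℝ) :
    IsSol D w μ (shootU D w μ) (shootZ D w μ) := by
  obtain ⟨A, R, h⟩ := exists_shootCoeff_bound hw hD
  refine ⟨(continuous_shootU hw hD).comp (by fun_prop : Continuous fun x : ℝ => (μ, x)),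
    (continuous_shootZ hw hD).comp (by fun_prop : Continuous fun x : ℝ => (μ, x)),
    fun x hx => ?_, fun x hx => ?_⟩
  · have h1 := (hw.inv.volterra_coeffSeries
      (fun k => hw.continuous_volterra (continuous_shootCoeff hw k))
      (fun k x hx => (h k x hx).2) μ hx).mul_left (-μ)
    have h2 : HasSum (fun k => (-μ) ^ (k + 1) * shootCoeff w (k + 1) x)
        (-μ * volterra (fun x => (w x)⁻¹) (shootZ D w μ) x) := by
      have e : ∀ k, (-μ) ^ (k + 1) * shootCoeff w (k + 1) x = -μ * ((-μ) ^ k *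
          volterra (fun x => (w x)⁻¹) (volterra w (shootCoeff w k)) x) := by
        intro k
        rw [pow_succ']; exact mul_assoc _ _ _
      simp only [e]
      exact h1
    rw [shootU_zero hD, shootU, coeffSeries, clamp_of_mem hx,
      (summable_coeff (fun k x hx => (h k x hx).1) μ hx).tsum_eq_zero_add, h2.tsum_eq]
    simp [shootCoeff, sub_eq_add_neg]
  · rw [shootZ, coeffSeries, clamp_of_mem hx]
    exact (hw.volterra_coeffSeries (continuous_shootCoeff hw)
      (fun k x hx => (h k x hx).1) μ hx).tsum_eq

end Shoot

/-! ### Uniqueness for the first-order system -/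

theorem le_of_rightDeriv_nonneg {f f' : ℝ → ℝ} {a b : ℝ} (hab : a ≤ b)
    (hf : ContinuousOn f (Icc a b))
    (hd : ∀ x ∈ Ico a b, HasDerivWithinAt f (f' x) (Ici x) x) (h : ∀ x ∈ Ico a b, 0 ≤ f' x) :
    f a ≤ f b :=
  image_le_of_deriv_right_le_deriv_boundary (f := fun _ => f a) (f' := fun _ => 0)
    continuousOn_const (fun x _ => hasDerivWithinAt_const x _ _) le_rfl hf hd h
    (right_mem_Icc.2 hab)

namespace IsSol

variable {D : ℝ} {w : ℝ → ℝ} {μ : ℝ} {u Z : ℝ → ℝ}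

theorem Z_zero (h : IsSol D w μ u Z) (hD : 0 ≤ D) : Z 0 = 0 := by
  rw [h.eq_Z 0 ⟨le_rfl, hD⟩, volterra, intervalIntegral.integral_same]

theorem linear_comb {u₂ Z₂ : ℝ → ℝ} (hw : IsWeight w) (h : IsSol D w μ u Z)
    (h₂ : IsSol D w μ u₂ Z₂) (c : ℝ) :
    IsSol D w μ (fun x => u x - c * u₂ x) (fun x => Z x - c * Z₂ x) where
  cont_u := h.cont_u.sub (h₂.cont_u.const_mul c)
  cont_Z := h.cont_Z.sub (h₂.cont_Z.const_mul c)
  eq_u x hx := by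
    have : volterra (fun x => (w x)⁻¹) (fun x => Z x - c * Z₂ x) x =
        volterra (fun x => (w x)⁻¹) Z x - c * volterra (fun x => (w x)⁻¹) Z₂ x := by
      simp only [volterra]
      rw [← intervalIntegral.integral_const_mul, ← intervalIntegral.integral_sub
        (hw.inv.intervalIntegrable_mul h.cont_Z _ _)
        ((hw.inv.intervalIntegrable_mul h₂.cont_Z _ _).const_mul c)]
      congr 1; ext t; ring
    rw [this, h.eq_u x hx, h₂.eq_u x hx]; ring
  eq_Z x hx := by
    simp only [h.eq_Z x hx, h₂.eq_Z x hx, volterra]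
    rw [← intervalIntegral.integral_const_mul, ← intervalIntegral.integral_sub
      (hw.intervalIntegrable_mul h.cont_u _ _)
      ((hw.intervalIntegrable_mul h₂.cont_u _ _).const_mul c)]
    congr 1; ext t; ring

theorem eventually_mem_Icc {x : ℝ} (hx : x ∈ Ico 0 D) : ∀ᶠ y in 𝓝[≥] x, y ∈ Icc 0 D := by
  filter_upwards [Icc_mem_nhdsGE hx.2] with y hy using ⟨hx.1.trans hy.1, hy.2⟩

theorem hasDerivWithinAt_Z (hw : IsWeight w) (h : IsSol D w μ u Z) {x : ℝ} (hx : x ∈ Ico 0 D) :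
    HasDerivWithinAt Z (w x * u x) (Ici x) x :=
  (hw.hasDerivWithinAt_volterra h.cont_u x).congr_of_eventuallyEq
    ((eventually_mem_Icc hx).mono fun y hy => h.eq_Z y hy) (h.eq_Z x (Ico_subset_Icc_self hx))

theorem hasDerivWithinAt_u (hw : IsWeight w) (h : IsSol D w μ u Z) {x : ℝ} (hx : x ∈ Ico 0 D) :
    HasDerivWithinAt u (-(μ * ((w x)⁻¹ * Z x))) (Ici x) x :=
  (((hw.inv.hasDerivWithinAt_volterra h.cont_Z x).const_mul μ).const_sub (u 0)).congr_of_eventuallyEq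
    ((eventually_mem_Icc hx).mono fun y hy => h.eq_u y hy) (h.eq_u x (Ico_subset_Icc_self hx))

theorem hasDerivAt_Z (hw : IsWeight w) (h : IsSol D w μ u Z) {x : ℝ} (hx : x ∈ Ioo 0 D)
    (hc : ContinuousAt w x) : HasDerivAt Z (w x * u x) x :=
  (hw.hasDerivAt_volterra h.cont_u hc).congr_of_eventuallyEq
    (Filter.Eventually.mono (Icc_mem_nhds hx.1 hx.2) fun y hy => h.eq_Z y hy)

/-- The two-sided growth estimate for the energy `u² + Z²`. -/
theorem energy_estimate (hw : IsWeight w) (h : IsSol D w μ u Z) : ∃ K, ∀ x ∈ Icc 0 D,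
    u 0 ^ 2 + Z 0 ^ 2 ≤ (u x ^ 2 + Z x ^ 2) * Real.exp (K * x) ∧
    (u x ^ 2 + Z x ^ 2) * Real.exp (-K * x) ≤ u 0 ^ 2 + Z 0 ^ 2 := by
  obtain ⟨B, hB0, hB⟩ := hw.exists_bound
  -- The right derivative of u² + Z² is 2(w - μ/w) u Z, of absolute value at most K(u² + Z²) for
  -- this K. Hence the energy times exp(Kx) increases and the energy times exp(-Kx) decreases.
  refine ⟨B + |μ| * B, fun x hx => ?_⟩
  set K := B + |μ| * B
  have hE : ∀ κ : ℝ, ∀ y ∈ Ico 0 x,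
      HasDerivWithinAt (fun y => (u y ^ 2 + Z y ^ 2) * Real.exp (κ * y))
        ((2 * (w y - μ * (w y)⁻¹) * (u y * Z y) + κ * (u y ^ 2 + Z y ^ 2)) * Real.exp (κ * y))
        (Ici y) y := by
    intro κ y hy
    have hy' : y ∈ Ico 0 D := ⟨hy.1, hy.2.trans_le hx.2⟩
    have h1 := ((h.hasDerivWithinAt_u hw hy').pow 2).add ((h.hasDerivWithinAt_Z hw hy').pow 2)
    have h2 : HasDerivWithinAt (fun y : ℝ => Real.exp (κ * y)) (Real.exp (κ * y) * (κ * 1))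
        (Ici y) y := (((hasDerivAt_id y).const_mul κ).exp).hasDerivWithinAt
    refine (h1.mul h2).congr_deriv ?_
    simp only [Pi.add_apply, Pi.pow_apply]
    ring
  have hcont : ∀ κ : ℝ, Continuous fun y => (u y ^ 2 + Z y ^ 2) * Real.exp (κ * y) := by
    intro κ
    have := h.cont_u; have := h.cont_Z
    fun_prop
  have hbound : ∀ y, |2 * (w y - μ * (w y)⁻¹) * (u y * Z y)| ≤ K * (u y ^ 2 + Z y ^ 2) := by
    intro y
    have h1 : |w y - μ * (w y)⁻¹| ≤ K := by
      refine (abs_sub _ _).trans ?_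
      rw [abs_mul, abs_of_pos (hw.pos y), abs_of_pos (inv_pos.2 (hw.pos y))]
      exact add_le_add (hB y).1 (mul_le_mul_of_nonneg_left (hB y).2 (abs_nonneg _))
    have h2 : |2 * (u y * Z y)| ≤ u y ^ 2 + Z y ^ 2 :=
      abs_le.2 ⟨by nlinarith [sq_nonneg (u y + Z y)], by nlinarith [sq_nonneg (u y - Z y)]⟩
    calc _ = |w y - μ * (w y)⁻¹| * |2 * (u y * Z y)| := by rw [← abs_mul]; ring_nf
      _ ≤ _ := mul_le_mul h1 h2 (abs_nonneg _) ((abs_nonneg _).trans h1)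
  constructor
  · have := le_of_rightDeriv_nonneg hx.1 (hcont K).continuousOn (hE K) (fun y _ =>
      mul_nonneg (by linarith [neg_le_of_abs_le (hbound y)]) (Real.exp_pos _).le)
    simpa using this
  · have := le_of_rightDeriv_nonneg hx.1 (hcont (-K)).neg.continuousOn (fun y hy => (hE (-K) y hy).neg)
      (fun y _ => by
        rw [← neg_mul]
        exact mul_nonneg (by linarith [le_of_abs_le (hbound y)]) (Real.exp_pos _).le)
    simpa using this

theorem eq_zero_of_initial (hw : IsWeight w) (h : IsSol D w μ u Z) (h0 : u 0 = 0) {x : ℝ}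
    (hx : x ∈ Icc 0 D) : u x = 0 ∧ Z x = 0 := by
  obtain ⟨K, hK⟩ := h.energy_estimate hw
  have h1 := (hK x hx).2
  rw [h0, h.Z_zero (hx.1.trans hx.2)] at h1
  have h2 : u x ^ 2 + Z x ^ 2 ≤ 0 := by
    by_contra! h3
    have := mul_pos h3 (Real.exp_pos (-K * x))
    linarith
  constructor <;> nlinarith [sq_nonneg (u x), sq_nonneg (Z x)]

theorem initial_eq_zero (hw : IsWeight w) (h : IsSol D w μ u Z) {x : ℝ} (hx : x ∈ Icc 0 D)
    (hu : u x = 0) (hZ : Z x = 0) : u 0 = 0 := by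
  obtain ⟨K, hK⟩ := h.energy_estimate hw
  have h1 := (hK x hx).1
  rw [hu, hZ] at h1
  nlinarith [sq_nonneg (u 0), sq_nonneg (Z 0)]

theorem eq_shoot (hw : IsWeight w) (h : IsSol D w μ u Z) {x : ℝ} (hx : x ∈ Icc 0 D) :
    u x = u 0 * shootU D w μ x ∧ Z x = u 0 * shootZ D w μ x := by
  have hD := hx.1.trans hx.2
  have h1 := (h.linear_comb hw (isSol_shoot hw hD μ) (u 0)).eq_zero_of_initial hw
    (by rw [shootU_zero hD]; ring) hx
  exact ⟨by linarith [h1.1], by linarith [h1.2]⟩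

end IsSol

/-! ### Sturm comparison for fluxes -/

namespace IsSol

variable {D : ℝ} {w : ℝ → ℝ} {μ : ℝ} {u Z : ℝ → ℝ}

/-- Near 0 the derivative w u of Z lies between positive constants, since u is close to 1. This
controls the quotient in Picone's function at 0, where both fluxes vanish. -/
theorem exists_linear_bounds (hw : IsWeight w) (hD : 0 < D) (h : IsSol D w μ u Z) (h0 : u 0 = 1) :
    ∃ δ c C, 0 < δ ∧ δ ≤ D ∧ 0 < c ∧ ∀ x ∈ Icc 0 δ, c * x ≤ Z x ∧ Z x ≤ C * x := by
  obtain ⟨m, hm, hm'⟩ := hw.lower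
  obtain ⟨M, hM⟩ := hw.upper
  have h1 : ∀ᶠ x in 𝓝 (0 : ℝ), u x ∈ Ioo (1 / 2) 2 :=
    h.cont_u.continuousAt.eventually (Ioo_mem_nhds (by rw [h0]; norm_num) (by rw [h0]; norm_num))
  obtain ⟨ε, hε, h2⟩ := Metric.eventually_nhds_iff.1 h1
  refine ⟨min D (ε / 2), m * (1 / 2), M * 2, lt_min hD (by linarith), min_le_left _ _,
    by linarith, fun x hx => ?_⟩
  have hy : ∀ y ∈ Ico 0 x, y ∈ Ico 0 D ∧ u y ∈ Ioo (1 / 2) 2 := fun y hy => by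
    have := hx.2.trans (min_le_right _ _)
    refine ⟨⟨hy.1, hy.2.trans_le (hx.2.trans (min_le_left _ _))⟩, h2 ?_⟩
    rw [Real.dist_eq, sub_zero, abs_of_nonneg hy.1]
    linarith [hy.2]
  have hZ0 := h.Z_zero hD.le
  have hid : ∀ (c : ℝ) y, HasDerivWithinAt (fun y => c * y) c (Ici y) y := fun c y => by
    simpa using ((hasDerivAt_id y).const_mul c).hasDerivWithinAt
  constructor
  · have := le_of_rightDeriv_nonneg hx.1 (f := fun y => Z y - m * (1 / 2) * y)
      (h.cont_Z.sub (continuous_const_mul _)).continuousOn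
      (fun y h3 => (h.hasDerivWithinAt_Z hw (hy y h3).1).sub (hid _ y))
      (fun y h3 => sub_nonneg.2 (mul_le_mul (hm' y) (hy y h3).2.1.le (by norm_num) (hw.pos y).le))
    simp only [hZ0] at this
    linarith
  · have := le_of_rightDeriv_nonneg hx.1 (f := fun y => M * 2 * y - Z y)
      ((continuous_const_mul _).sub h.cont_Z).continuousOn
      (fun y h3 => (hid _ y).sub (h.hasDerivWithinAt_Z hw (hy y h3).1))
      (fun y h3 => sub_nonneg.2 (mul_le_mul (hM y) (hy y h3).2.2.le
        (by linarith [(hy y h3).2.1]) ((hw.pos y).le.trans (hM y))))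
    simp only [hZ0] at this
    linarith

variable {w₂ : ℝ → ℝ} {μ₂ κ : ℝ} {v Y : ℝ → ℝ}

/-- Picone's identity, with the factor κ inserted so that κ w ≤ w₂ makes the second term
nonnegative. The third term is positive where Y ≠ 0 if μ w₂ < κ μ₂ w. -/
theorem picone_hasDerivWithinAt (hw : IsWeight w) (hw₂ : IsWeight w₂) (h : IsSol D w μ u Y)
    (h₂ : IsSol D w₂ μ₂ v Z) {x : ℝ} (hx : x ∈ Ico 0 D) (hZ : Z x ≠ 0) :
    HasDerivWithinAt (fun x => u x * Y x - κ * (Y x ^ 2 * v x / Z x))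
      (w x * (u x - κ * (Y x * v x / Z x)) ^ 2 + κ * (w₂ x - κ * w x) * (Y x * v x / Z x) ^ 2
        + Y x ^ 2 * (κ * μ₂ * (w₂ x)⁻¹ - μ * (w x)⁻¹)) (Ici x) x := by
  have hu := h.hasDerivWithinAt_u hw hx
  have hY := h.hasDerivWithinAt_Z hw hx
  have hv := h₂.hasDerivWithinAt_u hw₂ hx
  have hZ' := h₂.hasDerivWithinAt_Z hw₂ hx
  refine ((hu.mul hY).sub ((((hY.pow 2).mul hv).div hZ' hZ).const_mul κ)).congr_deriv ?_
  have := (hw.pos x).ne'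
  have := (hw₂.pos x).ne'
  simp only [Pi.mul_apply, Pi.pow_apply]
  field_simp
  ring

/-- Sturm's comparison theorem, by Picone's identity. -/
theorem picone_comparison (hw : IsWeight w) (hw₂ : IsWeight w₂) (hD : 0 < D)
    (h : IsSol D w μ u Y) (h₂ : IsSol D w₂ μ₂ v Z) (hu0 : u 0 = 1) (hv0 : v 0 = 1) (hκ : 0 < κ)
    (hle : ∀ x ∈ Icc 0 D, κ * w x ≤ w₂ x) (hlt : ∀ x ∈ Icc 0 D, μ * w₂ x < κ * μ₂ * w x)
    (hY : Y D = 0) : ∃ x ∈ Ioc 0 D, Z x ≤ 0 := by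
  by_contra! hZ
  set Φ : ℝ → ℝ := fun x => u x * Y x - κ * (Y x ^ 2 * v x / Z x) with hΦ
  obtain ⟨δ, c, C, hδ, hδD, hc, hYb⟩ := h.exists_linear_bounds hw hD hu0
  obtain ⟨δ', c', C', hδ', hδD', hc', hZb⟩ := h₂.exists_linear_bounds hw₂ hD hv0
  have hcoef : ∀ x ∈ Icc 0 D, 0 < κ * μ₂ * (w₂ x)⁻¹ - μ * (w x)⁻¹ := by
    intro x hx
    have h1 := hw.pos x
    have h2 := hw₂.pos x
    rw [sub_pos, ← div_eq_mul_inv, ← div_eq_mul_inv, div_lt_div_iff₀ h1 h2]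
    exact hlt x hx
  have hnonneg : ∀ x ∈ Icc 0 D, 0 ≤ w x * (u x - κ * (Y x * v x / Z x)) ^ 2
      + κ * (w₂ x - κ * w x) * (Y x * v x / Z x) ^ 2 := by
    intro x hx
    have h1 := (hw.pos x).le
    have h2 := sub_nonneg.2 (hle x hx)
    positivity
  have hcont : ContinuousOn Φ (Ioc 0 D) := by
    have := h.cont_u; have := h.cont_Z; have := h₂.cont_u; have := h₂.cont_Z
    refine ContinuousOn.sub (by fun_prop) (continuousOn_const.mul
      (ContinuousOn.div (by fun_prop) (by fun_prop) fun x hx => (hZ x hx).ne'))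
  have hmono : ∀ x y, 0 < x → x ≤ y → y ≤ D → Φ x ≤ Φ y := by
    intro x y hx hxy hy
    refine le_of_rightDeriv_nonneg hxy
      (hcont.mono fun t ht => ⟨hx.trans_le ht.1, ht.2.trans hy⟩) (fun t ht => ?_) (fun t ht => ?_)
      (f' := fun x => w x * (u x - κ * (Y x * v x / Z x)) ^ 2
        + κ * (w₂ x - κ * w x) * (Y x * v x / Z x) ^ 2
        + Y x ^ 2 * (κ * μ₂ * (w₂ x)⁻¹ - μ * (w x)⁻¹))
    · exact picone_hasDerivWithinAt hw hw₂ h h₂ ⟨hx.le.trans ht.1, ht.2.trans_le hy⟩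
        (hZ t ⟨hx.trans_le ht.1, ht.2.le.trans hy⟩).ne'
    · have ht' : t ∈ Icc 0 D := ⟨hx.le.trans ht.1, ht.2.le.trans hy⟩
      exact add_nonneg (hnonneg t ht') (mul_nonneg (sq_nonneg _) (hcoef t ht').le)
  -- Both fluxes are comparable to x near 0, so Y² v / Z is O(x).
  have hlim : Tendsto Φ (𝓝[>] 0) (𝓝 0) := by
    have hr : Tendsto (fun x => Y x ^ 2 * v x / Z x) (𝓝[>] 0) (𝓝 0) := by
      have hb : Tendsto (fun x => C ^ 2 / c' * |v x| * x) (𝓝[>] 0) (𝓝 0) := by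
        have : Continuous fun x => C ^ 2 / c' * |v x| * x :=
          (continuous_const.mul h₂.cont_u.abs).mul continuous_id
        simpa using (this.tendsto 0).mono_left nhdsWithin_le_nhds
      refine squeeze_zero_norm' ?_ hb
      filter_upwards [Ioo_mem_nhdsGT (lt_min hδ hδ')] with x hx
      have h1 := hYb x ⟨hx.1.le, hx.2.le.trans (min_le_left _ _)⟩
      have h2 := (hZb x ⟨hx.1.le, hx.2.le.trans (min_le_right _ _)⟩).1
      have h3 : 0 ≤ c * x := mul_nonneg hc.le hx.1.le
      have h4 : 0 < c' * x := mul_pos hc' hx.1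
      rw [norm_div, norm_mul, Real.norm_eq_abs, Real.norm_eq_abs, Real.norm_eq_abs,
        abs_of_nonneg (sq_nonneg _), abs_of_pos (h4.trans_le h2)]
      calc Y x ^ 2 * |v x| / Z x ≤ (C * x) ^ 2 * |v x| / (c' * x) := by
            have h5 := h1.2
            have h6 := h3.trans h1.1
            gcongr
        _ = _ := by have := hx.1.ne'; field_simp
    have hu : Tendsto (fun x => u x * Y x) (𝓝[>] 0) (𝓝 0) := by
      have ht : Tendsto (fun x => u x * Y x) (𝓝[>] 0) (𝓝 (u 0 * Y 0)) :=
        ((h.cont_u.mul h.cont_Z).tendsto 0).mono_left nhdsWithin_le_nhds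
      rwa [h.Z_zero hD.le, mul_zero] at ht
    simpa using hu.sub (hr.const_mul κ)
  have hge : ∀ y ∈ Ioc 0 D, 0 ≤ Φ y := by
    intro y hy
    refine le_of_tendsto hlim ?_
    filter_upwards [Ioc_mem_nhdsGT hy.1] with x hx using hmono x y hx.1 hx.2 hy.2
  -- `Φ` is monotone with value 0 at D and limit 0 at 0, hence identically 0. But at δ/2 the flux Y
  -- is positive, which makes the right derivative of `Φ` positive.
  have hΦD : Φ D = 0 := by simp [hΦ, hY]
  have hzero : ∀ y ∈ Ioc 0 D, Φ y = 0 := fun y hy =>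
    le_antisymm (hΦD ▸ hmono y D hy.1 hy.2 le_rfl) (hge y hy)
  have hx : δ / 2 ∈ Ico 0 D := ⟨by linarith, by linarith⟩
  have hx' : δ / 2 ∈ Ioc 0 D := ⟨by linarith, by linarith⟩
  have hd := picone_hasDerivWithinAt (κ := κ) hw hw₂ h h₂ hx (hZ _ hx').ne'
  have hd0 : HasDerivWithinAt Φ 0 (Ici (δ / 2)) (δ / 2) := by
    refine (hasDerivWithinAt_const (δ / 2) (Ici (δ / 2)) (0 : ℝ)).congr_of_eventuallyEq ?_
      (hzero _ hx')
    filter_upwards [Icc_mem_nhdsGE hx.2] with y hy using hzero y ⟨hx'.1.trans_le hy.1, hy.2⟩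
  have heq := (uniqueDiffOn_Ici (δ / 2) (δ / 2) self_mem_Ici).eq_deriv _ hd hd0
  have hYpos : 0 < Y (δ / 2) :=
    lt_of_lt_of_le (mul_pos hc (half_pos hδ)) (hYb _ ⟨by linarith, by linarith⟩).1
  have h3 := hnonneg _ (Ico_subset_Icc_self hx)
  have h4 := mul_pos (pow_pos hYpos 2) (hcoef _ (Ico_subset_Icc_self hx))
  linarith

end IsSol

/-! ### Eigenvalues as zeros of the shooting function -/

/-- The positive Neumann eigenvalues of a weight, as zeros of the shooting function. -/
def weightEigenvalues (D : ℝ) (w : ℝ → ℝ) : Set ℝ := {μ | 0 < μ ∧ shootZ D w μ D = 0}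

section Weight

variable {D : ℝ} {w : ℝ → ℝ}

theorem shootZ_zero_pos (hw : IsWeight w) (hD : 0 < D) {x : ℝ} (hx : x ∈ Ioc 0 D) :
    0 < shootZ D w 0 x := by
  have h := isSol_shoot hw hD.le 0
  have hx' := Ioc_subset_Icc_self hx
  rw [h.eq_Z x hx']
  refine intervalIntegral.intervalIntegral_pos_of_pos_on (hw.intervalIntegrable_mul h.cont_u _ _)
    (fun t ht => ?_) hx.1
  rw [h.eq_u t ⟨ht.1.le, ht.2.le.trans hx.2⟩, zero_mul, sub_zero, shootU_zero hD.le, mul_one]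
  exact hw.pos t

/-- Joint continuity and compactness keep u near its initial value 1 uniformly in μ. This separates
the zeros of interest from x = 0, where Z vanishes for every μ. -/
theorem exists_shootZ_pos_near_zero (hw : IsWeight w) (hD : 0 < D) (Λ : ℝ) :
    ∃ δ, 0 < δ ∧ δ ≤ D ∧ ∀ μ ∈ Icc 0 Λ, ∀ x ∈ Ioc 0 δ, 0 < shootZ D w μ x := by
  have hcomp : IsCompact (Icc (0 : ℝ) Λ) := isCompact_Icc
  have h1 : ∀ᶠ x in 𝓝 (0 : ℝ), ∀ μ ∈ Icc 0 Λ, 0 < shootU D w μ x := by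
    refine hcomp.eventually_forall_of_forall_eventually fun μ _ => ?_
    have := (continuous_shootU hw hD.le).comp (continuous_swap (X := ℝ) (Y := ℝ))
    refine (this.continuousAt (x := ((0 : ℝ), μ))).eventually (lt_mem_nhds ?_)
    simp [shootU_zero hD.le]
  obtain ⟨ε, hε, h2⟩ := Metric.eventually_nhds_iff.1 h1
  refine ⟨min D (ε / 2), lt_min hD (by linarith), min_le_left _ _, fun μ hμ x hx => ?_⟩
  have h := isSol_shoot hw hD.le μ
  rw [h.eq_Z x ⟨hx.1.le, hx.2.trans (min_le_left _ _)⟩]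
  refine intervalIntegral.intervalIntegral_pos_of_pos_on (hw.intervalIntegrable_mul h.cont_u _ _)
    (fun t ht => mul_pos (hw.pos t) (h2 ?_ μ hμ)) hx.1
  rw [Real.dist_eq, sub_zero, abs_of_pos ht.1]
  linarith [ht.2, hx.2.trans (min_le_right _ _)]

/-- A nonnegative shooting function has no zero in the interior. -/
theorem shootZ_ne_zero_of_nonneg (hw : IsWeight w) {μ : ℝ}
    {x : ℝ} (hx : x ∈ Ioo 0 D) (hnn : ∀ y ∈ Ioc 0 D, 0 ≤ shootZ D w μ y) : shootZ D w μ x ≠ 0 := by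
  intro h0
  have hD : 0 < D := hx.1.trans hx.2
  have h := isSol_shoot hw hD.le μ
  have hint : ∀ a b, IntervalIntegrable (fun t => w t * shootU D w μ t) MeasureTheory.volume a b :=
    fun a b => hw.intervalIntegrable_mul h.cont_u a b
  have hdiff : ∀ y ∈ Icc 0 D, shootZ D w μ y = ∫ t in x..y, w t * shootU D w μ t := by
    intro y hy
    rw [← sub_zero (shootZ D w μ y), ← h0, h.eq_Z y hy, h.eq_Z x (Ioo_subset_Icc_self hx)]
    exact intervalIntegral.integral_interval_sub_left (hint _ _) (hint _ _)
  -- Otherwise Z would be negative just to the right of x (if u(x) < 0) or just to the left (if u(x)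
  -- > 0). Once u and Z both vanish at x, the energy estimate forces u(0) = 0. Integrals replace the
  -- derivative of Z, since w may jump at x.
  have hu : shootU D w μ x = 0 := by
    rcases lt_trichotomy (shootU D w μ x) 0 with hneg | h00 | hpos
    · exfalso
      obtain ⟨ε, hε, h2⟩ := Metric.eventually_nhds_iff.1
        (h.cont_u.continuousAt.eventually (gt_mem_nhds hneg))
      set y := min D (x + ε / 2)
      have hxy : x < y := lt_min hx.2 (by linarith)
      have hyε : y ≤ x + ε / 2 := min_le_right _ _
      have hy : y ∈ Ioc 0 D := ⟨hx.1.trans hxy, min_le_left _ _⟩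
      have h3 := hnn y hy
      rw [hdiff y (Ioc_subset_Icc_self hy)] at h3
      have h4 := intervalIntegral.intervalIntegral_pos_of_pos_on (hint x y).neg (fun t ht => by
        have : shootU D w μ t < 0 := h2 (by
          rw [Real.dist_eq, abs_of_pos (by linarith [ht.1])]; linarith [ht.2])
        have := mul_pos (hw.pos t) (neg_pos.2 this)
        simpa using this) hxy
      simp only [Pi.neg_apply, intervalIntegral.integral_neg] at h4
      linarith
    · exact h00
    · exfalso
      obtain ⟨ε, hε, h2⟩ := Metric.eventually_nhds_iff.1
        (h.cont_u.continuousAt.eventually (lt_mem_nhds hpos))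
      set y := max (x / 2) (x - ε / 2)
      have hxy : y < x := max_lt (by linarith [hx.1]) (by linarith)
      have hyε : x - ε / 2 ≤ y := le_max_right _ _
      have hy : y ∈ Ioc 0 D := ⟨lt_max_of_lt_left (by linarith [hx.1]), hxy.le.trans hx.2.le⟩
      have h3 := hnn y hy
      rw [hdiff y (Ioc_subset_Icc_self hy), intervalIntegral.integral_symm] at h3
      have h4 := intervalIntegral.intervalIntegral_pos_of_pos_on (hint y x) (fun t ht =>
        mul_pos (hw.pos t) (h2 (by
          rw [Real.dist_eq, abs_of_neg (by linarith [ht.2])]; linarith [ht.1]))) hxy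
      linarith
  have := h.initial_eq_zero hw (Ioo_subset_Icc_self hx) hu h0
  rw [shootU_zero hD.le] at this
  exact one_ne_zero this

/-- Among the pairs (μ, x) with μ ≤ Λ and Z ≤ 0, compact once x is kept away from 0, one with least
μ is chosen. For smaller parameters Z is positive, so by continuity Z is nonnegative at μ and
vanishes at x; an interior zero is excluded, hence x = D. -/
theorem exists_weightEigenvalue_le (hw : IsWeight w) (hD : 0 < D) {Λ : ℝ} (hΛ : 0 ≤ Λ)
    (h : ∃ x ∈ Ioc 0 D, shootZ D w Λ x ≤ 0) : ∃ μ ∈ weightEigenvalues D w, μ ≤ Λ := by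
  obtain ⟨δ, hδ, hδD, hpos⟩ := exists_shootZ_pos_near_zero hw hD Λ
  have hc := continuous_shootZ hw hD.le
  have hK : IsCompact ((Icc 0 Λ ×ˢ Icc δ D) ∩ {q : ℝ × ℝ | shootZ D w q.1 q.2 ≤ 0}) :=
    (isCompact_Icc.prod isCompact_Icc).inter_right (isClosed_le hc continuous_const)
  obtain ⟨x, hx, hx0⟩ := h
  have hδx : ∀ μ ∈ Icc 0 Λ, ∀ x, 0 < x → shootZ D w μ x ≤ 0 → δ < x := by
    intro μ hμ x hx h0
    by_contra! hle
    exact absurd (hpos μ hμ x ⟨hx, hle⟩) h0.not_gt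
  have hne : ((Icc 0 Λ ×ˢ Icc δ D) ∩ {q : ℝ × ℝ | shootZ D w q.1 q.2 ≤ 0}).Nonempty :=
    ⟨(Λ, x), ⟨⟨⟨hΛ, le_rfl⟩, (hδx Λ ⟨hΛ, le_rfl⟩ x hx.1 hx0).le, hx.2⟩, hx0⟩⟩
  obtain ⟨⟨μ, z⟩, ⟨⟨hμ, hz⟩, h0⟩, hmin⟩ := hK.exists_isMinOn hne continuous_fst.continuousOn
  simp only [mem_ofPred_eq] at h0 hμ hz
  have hz' : z ∈ Ioc 0 D := ⟨hδ.trans_le hz.1, hz.2⟩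
  have hμ0 : 0 < μ := by
    refine hμ.1.lt_of_ne fun he => ?_
    rw [← he] at h0
    exact absurd (shootZ_zero_pos hw hD hz') h0.not_gt
  have hbelow : ∀ ν ∈ Ico 0 μ, ∀ y ∈ Ioc 0 D, 0 < shootZ D w ν y := by
    intro ν hν y hy
    by_contra! hle
    have hν' : ν ∈ Icc 0 Λ := ⟨hν.1, hν.2.le.trans hμ.2⟩
    have := hmin (show (ν, y) ∈ _ from ⟨⟨hν', (hδx ν hν' y hy.1 hle).le, hy.2⟩, hle⟩)
    exact absurd hν.2 (not_lt.2 this)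
  have hnn : ∀ y ∈ Ioc 0 D, 0 ≤ shootZ D w μ y := by
    intro y hy
    have ht : Tendsto (fun ν => shootZ D w ν y) (𝓝[<] μ) (𝓝 (shootZ D w μ y)) :=
      ((hc.comp (Continuous.prodMk_left y)).tendsto μ).mono_left nhdsWithin_le_nhds
    refine ge_of_tendsto ht ?_
    filter_upwards [Ico_mem_nhdsLT hμ0] with ν hν using (hbelow ν hν y hy).le
  have hz0 : shootZ D w μ z = 0 := le_antisymm h0 (hnn z hz')
  have hzD : z = D := by
    by_contra hne
    exact shootZ_ne_zero_of_nonneg hw ⟨hz'.1, hz'.2.lt_of_ne hne⟩ hnn hz0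
  exact ⟨μ, ⟨hμ0, hzD ▸ hz0⟩, hμ.2⟩

theorem weightEigenvalues_isLeast (hw : IsWeight w) (hD : 0 < D)
    (hne : (weightEigenvalues D w).Nonempty) :
    IsLeast (weightEigenvalues D w) (sInf (weightEigenvalues D w)) := by
  -- At μ = 0 the shooting function is the integral of w, hence nonzero, so 0 < μ may be replaced by
  -- the closed condition 0 ≤ μ.
  have he : weightEigenvalues D w = Ici 0 ∩ {μ | shootZ D w μ D = 0} := by
    ext μ
    refine ⟨fun h => ⟨h.1.le, h.2⟩, fun h => ⟨h.1.lt_of_ne fun h0 => ?_, h.2⟩⟩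
    have h1 := shootZ_zero_pos hw hD ⟨hD, le_rfl⟩
    have h2 : shootZ D w μ D = 0 := h.2
    rw [← h0] at h2
    exact h1.ne' h2
  have hcl : IsClosed (weightEigenvalues D w) := by
    rw [he]
    exact isClosed_Ici.inter (isClosed_eq
      ((continuous_shootZ hw hD.le).comp (Continuous.prodMk_left D)) continuous_const)
  exact hcl.isLeast_csInf hne ⟨0, fun μ hμ => hμ.1.le⟩

theorem exists_weightEigenvalue_le_of_comparison {w₂ u Y : ℝ → ℝ} {μ : ℝ} (hw : IsWeight w)
    (hw₂ : IsWeight w₂) (hD : 0 < D) (hsol : IsSol D w μ u Y) (hu : u 0 = 1) (hY : Y D = 0)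
    (hμ : 0 < μ) {κ ρ : ℝ} (hκ : 0 < κ)
    (hle : ∀ x ∈ Icc 0 D, κ * w x ≤ w₂ x ∧ w₂ x ≤ ρ * w x) {Λ : ℝ} (hΛ : ρ / κ * μ < Λ) :
    ∃ ν ∈ weightEigenvalues D w₂, ν ≤ Λ := by
  have hρ : κ ≤ ρ := by
    have := hle 0 ⟨le_rfl, hD.le⟩
    exact le_of_mul_le_mul_right (this.1.trans this.2) (hw.pos 0)
  have h1 : ρ * μ < κ * Λ := by
    rw [div_mul_eq_mul_div, div_lt_iff₀ hκ] at hΛ; linarith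
  have hΛ0 : 0 < Λ := lt_of_le_of_lt (by have := hκ.trans_le hρ; positivity) hΛ
  refine exists_weightEigenvalue_le hw₂ hD hΛ0.le ?_
  refine hsol.picone_comparison hw hw₂ hD (isSol_shoot hw₂ hD.le Λ) hu (shootU_zero hD.le Λ) hκ
    (fun x hx => (hle x hx).1) (fun x hx => ?_) hY
  calc μ * w₂ x ≤ μ * (ρ * w x) := mul_le_mul_of_nonneg_left (hle x hx).2 hμ.le
    _ = ρ * μ * w x := by ring
    _ < κ * Λ * w x := mul_lt_mul_of_pos_right h1 (hw.pos x)

theorem isWeight_one : IsWeight fun _ => 1 where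
  measurable := measurable_const
  right_cont _ := continuousWithinAt_const
  lower := ⟨1, one_pos, fun _ => le_rfl⟩
  upper := ⟨1, fun _ => le_rfl⟩

theorem isSol_one {θ : ℝ} (hθ : θ ≠ 0) :
    IsSol D (fun _ => 1) (θ ^ 2) (fun x => Real.cos (θ * x)) (fun x => Real.sin (θ * x) / θ) where
  cont_u := by fun_prop
  cont_Z := by fun_prop
  eq_u x _ := by
    simp only [volterra, inv_one, one_mul]
    rw [intervalIntegral.integral_div, intervalIntegral.integral_comp_mul_left _ hθ]
    simp
    field_simp
    ring
  eq_Z x _ := by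
    simp only [volterra, one_mul]
    rw [intervalIntegral.integral_comp_mul_left _ hθ]
    simp
    field_simp

/-- Comparison with the constant weight 1, which has the eigenfunction cos(πx/D). -/
theorem weightEigenvalues_nonempty (hw : IsWeight w) (hD : 0 < D) :
    (weightEigenvalues D w).Nonempty := by
  obtain ⟨m, hm, hm'⟩ := hw.lower
  obtain ⟨M, hM⟩ := hw.upper
  have hθ : 0 < Real.pi / D := div_pos Real.pi_pos hD
  obtain ⟨ν, hν, -⟩ := exists_weightEigenvalue_le_of_comparison isWeight_one hw hD
    (isSol_one hθ.ne') (by simp) (by simp [div_mul_cancel₀ _ hD.ne']) (pow_pos hθ 2) hm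
    (fun x _ => ⟨by simpa using hm' x, by simpa using hM x⟩) (lt_add_one _)
  exact ⟨ν, hν⟩

/-- Comparison of the lowest eigenvalues of two weights. -/
theorem sInf_weightEigenvalues_le {w₂ : ℝ → ℝ} (hw : IsWeight w) (hw₂ : IsWeight w₂) (hD : 0 < D)
    {κ ρ : ℝ} (hκ : 0 < κ) (hle : ∀ x ∈ Icc 0 D, κ * w x ≤ w₂ x ∧ w₂ x ≤ ρ * w x) :
    sInf (weightEigenvalues D w₂) ≤ ρ / κ * sInf (weightEigenvalues D w) := by
  have h1 := (weightEigenvalues_isLeast hw hD (weightEigenvalues_nonempty hw hD)).1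
  -- Picone's argument needs a strict inequality between the parameters, so the bound is approached
  -- from above.
  refine le_of_forall_gt_imp_ge_of_dense fun Λ hΛ => ?_
  obtain ⟨ν, hν, hνΛ⟩ := exists_weightEigenvalue_le_of_comparison hw hw₂ hD
    (isSol_shoot hw hD.le _) (shootU_zero hD.le _) h1.2 h1.1 hκ hle hΛ
  exact (csInf_le ⟨0, fun μ hμ => hμ.1.le⟩ hν).trans hνΛ

end Weight

/-! ### The Neumann problem for a continuous weight -/

section Neumann

variable {D : ℝ} {ω : ℝ → ℝ}

theorem continuous_comp_clamp (hD : 0 ≤ D) {f : ℝ → ℝ} (hf : ContinuousOn f (Icc 0 D)) :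
    Continuous fun x => f (clamp D x) :=
  hf.comp_continuous (continuous_clamp D) (clamp_mem hD)

theorem isWeight_of_continuous {w : ℝ → ℝ} (hw : Continuous w) {m M : ℝ} (hm : 0 < m)
    (hb : ∀ x, m ≤ w x ∧ w x ≤ M) : IsWeight w where
  measurable := hw.measurable
  right_cont _ := hw.continuousWithinAt
  lower := ⟨m, hm, fun x => (hb x).1⟩
  upper := ⟨M, fun x => (hb x).2⟩

theorem exists_bounds_clamp (hD : 0 ≤ D) (hω : ContinuousOn ω (Icc 0 D))
    (hpos : ∀ x ∈ Icc 0 D, 0 < ω x) :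
    ∃ m M, 0 < m ∧ ∀ x, m ≤ ω (clamp D x) ∧ ω (clamp D x) ≤ M := by
  have hne : (Icc 0 D).Nonempty := ⟨0, le_rfl, hD⟩
  obtain ⟨a, ha, ha'⟩ := isCompact_Icc.exists_isMinOn hne hω
  obtain ⟨b, hb, hb'⟩ := isCompact_Icc.exists_isMaxOn hne hω
  exact ⟨ω a, ω b, hpos a ha, fun x => ⟨ha' (clamp_mem hD x), hb' (clamp_mem hD x)⟩⟩

theorem isWeight_comp_clamp (hD : 0 ≤ D) (hω : ContinuousOn ω (Icc 0 D))
    (hpos : ∀ x ∈ Icc 0 D, 0 < ω x) : IsWeight fun x => ω (clamp D x) := by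
  obtain ⟨m, M, hm, hb⟩ := exists_bounds_clamp hD hω hpos
  exact isWeight_of_continuous (continuous_comp_clamp hD hω) hm hb

theorem IsNeumannEigenfunction.isSol {μ : ℝ} {u u' : ℝ → ℝ} (hD : 0 < D)
    (hω : ContinuousOn ω (Icc 0 D)) (hpos : ∀ x ∈ Icc 0 D, 0 < ω x) (hμ : μ ≠ 0)
    (h : IsNeumannEigenfunction D ω μ u u') :
    IsSol D (fun x => ω (clamp D x)) μ (fun x => u (clamp D x))
      (fun x => -(ω (clamp D x) * u' (clamp D x)) / μ) := by
  have huc : ContinuousOn u (Icc 0 D) := fun x hx => (h.deriv x hx).continuousWithinAt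
  have c1 := continuous_comp_clamp hD.le hω
  have c2 := continuous_comp_clamp hD.le huc
  have c3 := continuous_comp_clamp hD.le h.deriv_cont
  refine ⟨c2, ((c1.mul c3).neg).div_const μ, fun x hx => ?_, fun x hx => ?_⟩
  · have h1 : ∫ t in (0 : ℝ)..x, u' (clamp D t) = u x - u 0 := by
      refine intervalIntegral.integral_eq_sub_of_hasDerivAt_of_le hx.1
        (huc.mono (Icc_subset_Icc_right hx.2)) (fun t ht => ?_) (c3.intervalIntegrable _ _)
      have ht' : t ∈ Ioo 0 D := ⟨ht.1, ht.2.trans_le hx.2⟩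
      rw [clamp_of_mem (Ioo_subset_Icc_self ht')]
      exact (h.deriv t (Ioo_subset_Icc_self ht')).hasDerivAt (Icc_mem_nhds ht'.1 ht'.2)
    have h2 : μ * volterra (fun x => (ω (clamp D x))⁻¹)
        (fun x => -(ω (clamp D x) * u' (clamp D x)) / μ) x = -∫ t in (0 : ℝ)..x, u' (clamp D t) := by
      rw [volterra, ← intervalIntegral.integral_const_mul, ← intervalIntegral.integral_neg]
      refine intervalIntegral.integral_congr fun t _ => ?_
      have := (hpos _ (clamp_mem hD.le t)).ne'
      field_simp
    rw [h2, h1, clamp_of_mem hx, clamp_of_mem ⟨le_rfl, hD.le⟩]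
    ring
  · have h1 : ∫ t in (0 : ℝ)..x, -(μ * ω (clamp D t) * u (clamp D t)) =
        ω x * u' x - ω 0 * u' 0 := by
      refine intervalIntegral.integral_eq_sub_of_hasDerivAt_of_le hx.1
        ((hω.mul h.deriv_cont).mono (Icc_subset_Icc_right hx.2)) (fun t ht => ?_)
        (((c1.const_mul μ).mul c2).neg.intervalIntegrable _ _)
      have ht' : t ∈ Ioo 0 D := ⟨ht.1, ht.2.trans_le hx.2⟩
      rw [clamp_of_mem (Ioo_subset_Icc_self ht')]
      exact h.equation t ht'
    have h2 : -(μ * volterra (fun x => ω (clamp D x)) (fun x => u (clamp D x)) x) =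
        ω x * u' x := by
      rw [h.left, mul_zero, sub_zero] at h1
      rw [← h1, volterra,
        ← intervalIntegral.integral_const_mul, ← intervalIntegral.integral_neg]
      refine intervalIntegral.integral_congr fun t _ => ?_
      ring
    rw [clamp_of_mem hx, ← h2, neg_neg, mul_div_cancel_left₀ _ hμ]

/-- By uniqueness an eigenfunction is u(0) ≠ 0 times the shooting solution. The left boundary
condition is built into the initial data, and the right one becomes Z(D) = 0. -/
theorem positiveNeumannEigenvalues_eq (hD : 0 < D) (hω : ContinuousOn ω (Icc 0 D))
    (hpos : ∀ x ∈ Icc 0 D, 0 < ω x) :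
    positiveNeumannEigenvalues D ω = weightEigenvalues D fun x => ω (clamp D x) := by
  have hw := isWeight_comp_clamp hD.le hω hpos
  have hDm : D ∈ Icc 0 D := ⟨hD.le, le_rfl⟩
  have h0m : (0 : ℝ) ∈ Icc 0 D := ⟨le_rfl, hD.le⟩
  ext μ
  refine and_congr_right fun hμ => ⟨?_, fun h0 => ?_⟩
  · rintro ⟨u, u', h⟩
    have hs := h.isSol hD hω hpos hμ.ne'
    have h1 := (hs.eq_shoot hw hDm).2
    simp only [clamp_of_mem hDm, clamp_of_mem h0m, h.right] at h1
    have hu0 : u 0 ≠ 0 := by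
      intro hu0
      obtain ⟨x, hx, hne⟩ := h.nonzero
      have := (hs.eq_zero_of_initial hw (by simpa [clamp_of_mem h0m] using hu0) hx).1
      rw [clamp_of_mem hx] at this
      exact hne this
    simp only [mul_zero, neg_zero, zero_div] at h1
    exact (mul_eq_zero.1 h1.symm).resolve_left hu0
  · have hs := isSol_shoot hw hD.le μ
    have hci : ContinuousOn (fun x => (ω x)⁻¹) (Icc 0 D) := hω.inv₀ fun x hx => (hpos x hx).ne'
    refine ⟨shootU D (fun x => ω (clamp D x)) μ,
      fun x => -(μ * ((ω x)⁻¹ * shootZ D (fun x => ω (clamp D x)) μ x)),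
      ⟨0, h0m, by rw [shootU_zero hD.le]; exact one_ne_zero⟩, fun x hx => ?_, ?_, fun x hx => ?_,
      by simp [hs.Z_zero hD.le], by simp [h0]⟩
    · have h1 := hw.inv.hasDerivAt_volterra hs.cont_Z
        (((continuous_comp_clamp hD.le hω).inv₀ fun x => (hw.pos x).ne').continuousAt (x := x))
      have h2 := ((h1.const_mul μ).const_sub (shootU D (fun x => ω (clamp D x)) μ 0)).hasDerivWithinAt
        (s := Icc 0 D)
      simp only [clamp_of_mem hx] at h2
      exact h2.congr hs.eq_u (hs.eq_u x hx)
    · exact (continuousOn_const.mul (hci.mul hs.cont_Z.continuousOn)).neg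
    · have hx' := Ioo_subset_Icc_self hx
      have h1 := hs.hasDerivAt_Z hw hx (continuous_comp_clamp hD.le hω).continuousAt
      have h2 := (h1.const_mul μ).neg
      rw [clamp_of_mem hx', ← mul_assoc] at h2
      refine h2.congr_of_eventuallyEq (Filter.Eventually.mono (Icc_mem_nhds hx.1 hx.2) fun y hy => ?_)
      have := (hpos y hy).ne'
      field_simp
      rfl

end Neumann

/-! ### Geometry of pumpkin chains -/

namespace MetricGraph

variable {G : MetricGraph}

theorem edgePoint_zero (e : G.E) :
    G.edgePoint e ⟨0, le_refl 0, (G.len_pos e).le⟩ = G.vertexPoint (G.src e) :=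
  (Quot.sound (Glue.src e)).symm

theorem edgePoint_len (e : G.E) :
    G.edgePoint e ⟨G.len e, (G.len_pos e).le, le_refl (G.len e)⟩ = G.vertexPoint (G.tgt e) :=
  (Quot.sound (Glue.tgt e)).symm

theorem PathOfLength.symm {x y : G.Point} {L : ℝ} (h : G.PathOfLength x y L) :
    G.PathOfLength y x L := by
  induction h with
  | refl x => exact .refl x
  | segment e s t => rw [abs_sub_comm]; exact .segment e t s
  | concat _ _ h1 h2 => rw [add_comm]; exact h2.concat h1

theorem PathOfLength.nonneg {x y : G.Point} {L : ℝ} (h : G.PathOfLength x y L) : 0 ≤ L := by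
  induction h with
  | refl x => exact le_rfl
  | segment e s t => exact abs_nonneg _
  | concat _ _ h1 h2 => exact add_nonneg h1 h2

theorem pathOfLength_from_src (e : G.E) (s : Icc (0 : ℝ) (G.len e)) :
    G.PathOfLength (G.vertexPoint (G.src e)) (G.edgePoint e s) s := by
  have := PathOfLength.segment e ⟨0, le_refl 0, (G.len_pos e).le⟩ s
  rwa [edgePoint_zero, zero_sub, abs_neg, abs_of_nonneg s.2.1] at this

theorem pathOfLength_to_tgt (e : G.E) (s : Icc (0 : ℝ) (G.len e)) :
    G.PathOfLength (G.edgePoint e s) (G.vertexPoint (G.tgt e)) (G.len e - s) := by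
  have := PathOfLength.segment e s ⟨G.len e, (G.len_pos e).le, le_refl (G.len e)⟩
  rwa [edgePoint_len, abs_sub_comm, abs_of_nonneg (sub_nonneg.2 s.2.2)] at this

theorem pathOfLength_edge (e : G.E) :
    G.PathOfLength (G.vertexPoint (G.src e)) (G.vertexPoint (G.tgt e)) (G.len e) := by
  have := pathOfLength_from_src e ⟨G.len e, (G.len_pos e).le, le_refl (G.len e)⟩
  rwa [edgePoint_len] at this

/-- The chain of `k` pumpkins, the `i`-th of which has `m i` edges, all of length `D / k`. -/
noncomputable def pumpkinChain (D : ℝ) (hD : 0 < D) (k : ℕ) (hk : 0 < k) (m : ℕ → ℕ) (hm : ∀ i, 0 < m i) :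
    MetricGraph where
  V := Fin (k + 1)
  E := Σ i : Fin k, Fin (m i)
  src e := e.1.castSucc
  tgt e := e.1.succ
  len _ := D / k
  len_pos _ := div_pos hD (Nat.cast_pos.2 hk)
  connected := by
    have h : ∀ n (hn : n < k + 1), (SimpleGraph.fromRel fun v w : Fin (k + 1) =>
        ∃ e : Σ i : Fin k, Fin (m i), e.1.castSucc = v ∧ e.1.succ = w).Reachable 0 ⟨n, hn⟩ := by
      intro n
      induction n with
      | zero => exact fun _ => .rfl
      | succ n ih =>
        intro hn
        refine (ih (by omega)).trans (SimpleGraph.Adj.reachable ?_)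
        rw [SimpleGraph.fromRel_adj]
        exact ⟨by simp, Or.inl ⟨⟨⟨n, by omega⟩, ⟨0, hm n⟩⟩, rfl, rfl⟩⟩
    exact ⟨fun v w => (h v v.2).symm.trans (h w w.2)⟩

section PumpkinChain

variable (D : ℝ) (hD : 0 < D) (k : ℕ) (hk : 0 < k) (m : ℕ → ℕ) (hm : ∀ i, 0 < m i)

theorem pumpkinChain_adj (v w : Fin (k + 1)) :
    (pumpkinChain D hD k hk m hm).adjacency.Adj v w ↔ v.val + 1 = w.val ∨ w.val + 1 = v.val := by
  have key : ∀ v w : Fin (k + 1),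
      (∃ e : Σ i : Fin k, Fin (m i), e.1.castSucc = v ∧ e.1.succ = w) ↔ v.val + 1 = w.val := by
    intro v w
    constructor
    · rintro ⟨e, rfl, rfl⟩; simp
    · intro h
      exact ⟨⟨⟨v.val, by omega⟩, ⟨0, hm _⟩⟩, rfl, Fin.ext h⟩
  refine (SimpleGraph.fromRel_adj _ v w).trans ?_
  refine (and_congr_right fun _ => or_congr (key v w) (key w v)).trans ?_
  refine ⟨fun h => h.2, fun h => ⟨?_, h⟩⟩
  rintro rfl
  omega

theorem pumpkinChain_ncard_neighborSet (v : Fin (k + 1)) :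
    ((pumpkinChain D hD k hk m hm).adjacency.neighborSet v).ncard =
      if v = 0 ∨ v = Fin.last k then 1 else 2 := by
  have hmem : ∀ w : Fin (k + 1), w ∈ (pumpkinChain D hD k hk m hm).adjacency.neighborSet v ↔
      v.val + 1 = w.val ∨ w.val + 1 = v.val := fun w => pumpkinChain_adj D hD k hk m hm v w
  have hv := v.2
  split_ifs with h
  · rw [Set.ncard_eq_one]
    rcases h with rfl | rfl
    · refine ⟨(⟨1, by omega⟩ : Fin (k + 1)), Set.ext fun w => (hmem w).trans ?_⟩
      refine Iff.trans ?_ (Fin.ext_iff (a := w) (b := ⟨1, by omega⟩)).symm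
      simp only [Fin.val_zero]
      omega
    · refine ⟨(⟨k - 1, by omega⟩ : Fin (k + 1)), Set.ext fun w => (hmem w).trans ?_⟩
      refine Iff.trans ?_ (Fin.ext_iff (a := w) (b := ⟨k - 1, by omega⟩)).symm
      have := w.2
      simp only [Fin.val_last]
      omega
  · simp only [Fin.ext_iff, Fin.val_zero, Fin.val_last, not_or] at h
    rw [Set.ncard_eq_two]
    refine ⟨(⟨v - 1, by omega⟩ : Fin (k + 1)), (⟨v + 1, by omega⟩ : Fin (k + 1)), ?_,
      Set.ext fun w => (hmem w).trans ?_⟩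
    · intro he
      have := Fin.ext_iff.1 he
      simp only at this
      omega
    · refine Iff.trans ?_ (or_congr (Fin.ext_iff (a := w) (b := ⟨v - 1, by omega⟩))
        (Fin.ext_iff (a := w) (b := ⟨v + 1, by omega⟩))).symm
      simp only
      omega

theorem pumpkinChain_isPumpkinChain : (pumpkinChain D hD k hk m hm).IsPumpkinChain := by
  have h2 : ({0, Fin.last k} : Set (Fin (k + 1))).ncard = 2 :=
    Set.ncard_pair (by simp only [ne_eq, Fin.ext_iff, Fin.val_zero, Fin.val_last]; omega)
  refine ⟨fun e he => ?_, ?_, ?_, fun _ _ _ => rfl⟩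
  · exact Fin.castSucc_lt_succ.ne he
  · have h1 : {v : Fin (k + 1) |
        ((pumpkinChain D hD k hk m hm).adjacency.neighborSet v).ncard = 2} = {0, Fin.last k}ᶜ := by
      ext v
      simp only [mem_ofPred_eq, pumpkinChain_ncard_neighborSet, mem_compl_iff, mem_insert_iff,
        mem_singleton_iff]
      split_ifs with h <;> simp [h]
    have h3 := Set.ncard_add_ncard_compl ({0, Fin.last k} : Set (Fin (k + 1)))
    rw [h2, Nat.card_eq_fintype_card] at h3
    have h4 : {v : Fin (k + 1) |
        ((pumpkinChain D hD k hk m hm).adjacency.neighborSet v).ncard = 2}.ncard + 2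
        = Fintype.card (Fin (k + 1)) := by rw [h1, ← h3, add_comm]
    exact h4.trans (Fintype.card_congr (Equiv.refl _))
  · have h1 : {v : Fin (k + 1) |
        ((pumpkinChain D hD k hk m hm).adjacency.neighborSet v).ncard = 1} = {0, Fin.last k} := by
      ext v
      simp only [mem_ofPred_eq, pumpkinChain_ncard_neighborSet, mem_insert_iff,
        mem_singleton_iff]
      split_ifs with h <;> simp [h]
    exact (congrArg Set.ncard h1).trans h2

/-- The distance of a point of a pumpkin chain from the left end. -/
noncomputable def pumpkinHeight : (pumpkinChain D hD k hk m hm).Point → ℝ :=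
  Quot.lift (fun p : Fin (k + 1) ⊕ (Σ e : (pumpkinChain D hD k hk m hm).E,
      Icc (0 : ℝ) ((pumpkinChain D hD k hk m hm).len e)) =>
    p.elim (fun v => (v.val : ℝ) * (D / k)) (fun q => (q.1.1.val : ℝ) * (D / k) + q.2.1)) (by
    rintro _ _ (e | e)
    · exact (add_zero _).symm
    · change ((e.1.succ).val : ℝ) * (D / k) = (e.1.val : ℝ) * (D / k) + D / k
      rw [Fin.val_succ]; push_cast; ring)

/-- The height is 1-Lipschitz along paths; between the two end vertices this bounds every path
length below by D. -/
theorem abs_pumpkinHeight_sub_le {x y : (pumpkinChain D hD k hk m hm).Point} {L : ℝ}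
    (h : (pumpkinChain D hD k hk m hm).PathOfLength x y L) :
    |pumpkinHeight D hD k hk m hm x - pumpkinHeight D hD k hk m hm y| ≤ L := by
  induction h with
  | refl x => simp
  | segment e s t =>
    refine le_of_eq (congrArg _ ?_)
    change ((e.1.val : ℝ) * (D / k) + s.1) - ((e.1.val : ℝ) * (D / k) + t.1) = s.1 - t.1
    ring
  | concat _ _ h1 h2 => exact (abs_sub_le _ _ _).trans (add_le_add h1 h2)

theorem pathOfLength_vertexPoint (i n : ℕ) (h : i + n < k + 1) :
    (pumpkinChain D hD k hk m hm).PathOfLength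
      ((pumpkinChain D hD k hk m hm).vertexPoint (⟨i, by omega⟩ : Fin (k + 1)))
      ((pumpkinChain D hD k hk m hm).vertexPoint (⟨i + n, h⟩ : Fin (k + 1))) (n * (D / k)) := by
  induction n with
  | zero => simpa using PathOfLength.refl _
  | succ n ih =>
    have h1 := ih (by omega)
    have h2 := pathOfLength_edge (G := pumpkinChain D hD k hk m hm)
      (⟨⟨i + n, by omega⟩, ⟨0, hm _⟩⟩ : Σ i : Fin k, Fin (m i))
    have h3 := h1.concat h2
    have e : (n : ℝ) * (D / k) + D / k = ((n + 1 : ℕ) : ℝ) * (D / k) := by push_cast; ring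
    exact e ▸ h3

theorem exists_edgePoint (x : (pumpkinChain D hD k hk m hm).Point) :
    ∃ e s, x = (pumpkinChain D hD k hk m hm).edgePoint e s := by
  obtain ⟨p, rfl⟩ := Quot.exists_rep x
  rcases p with v | ⟨e, s⟩
  · obtain ⟨v, hv⟩ : ∃ v' : Fin (k + 1), v' = v := ⟨v, rfl⟩
    subst hv
    by_cases h : v.val < k
    · have he := edgePoint_zero (G := pumpkinChain D hD k hk m hm)
        (⟨⟨v.val, h⟩, ⟨0, hm _⟩⟩ : Σ i : Fin k, Fin (m i))
      exact ⟨_, _, he.symm⟩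
    · refine ⟨(⟨⟨k - 1, by omega⟩, ⟨0, hm _⟩⟩ : Σ i : Fin k, Fin (m i)), _,
        Eq.trans ?_ (edgePoint_len _).symm⟩
      refine congrArg (pumpkinChain D hD k hk m hm).vertexPoint ?_
      refine Fin.ext (a := v) (b := Fin.succ ⟨k - 1, by omega⟩) ?_
      have := v.2
      simp only [Fin.val_succ]
      omega
  · exact ⟨e, s, rfl⟩

theorem exists_path_of_lt (e f : Σ i : Fin k, Fin (m i)) (s t : Icc (0 : ℝ) (D / k))
    (hlt : e.1 < f.1) : ∃ L ≤ D, (pumpkinChain D hD k hk m hm).PathOfLength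
      ((pumpkinChain D hD k hk m hm).edgePoint e s)
      ((pumpkinChain D hD k hk m hm).edgePoint f t) L := by
  have hlt' : e.1.val < f.1.val := hlt
  have hf := f.1.2
  obtain ⟨n, hn⟩ := Nat.exists_eq_add_of_lt hlt'
  have h1 := pathOfLength_to_tgt (G := pumpkinChain D hD k hk m hm) e s
  have h2 := pathOfLength_vertexPoint D hD k hk m hm (e.1.val + 1) n (by omega)
  have h3 := pathOfLength_from_src (G := pumpkinChain D hD k hk m hm) f t
  have e1 : (⟨e.1.val + 1 + n, by omega⟩ : Fin (k + 1)) = f.1.castSucc :=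
    Fin.ext (by simp only [Fin.val_castSucc]; omega)
  rw [e1] at h2
  refine ⟨_, ?_, (h1.concat h2).concat h3⟩
  have hk' : (0 : ℝ) < k := Nat.cast_pos.2 hk
  have h4 : ((n : ℝ) + 2) * (D / k) ≤ k * (D / k) := by
    have : (n : ℝ) + 2 ≤ k := by exact_mod_cast (by omega : n + 2 ≤ k)
    have := div_pos hD hk'
    gcongr
  rw [mul_div_cancel₀ _ hk'.ne'] at h4
  have h5 := s.2.1
  have h6 := t.2.2
  change D / k - s.1 + n * (D / k) + t.1 ≤ D
  linarith

/-- Within one pumpkin, the routes through its two end vertices have total length 2D/k, so one of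
them is at most D/k. Between different pumpkins a path along the chain never turns back. -/
theorem exists_path_le (x y : (pumpkinChain D hD k hk m hm).Point) :
    ∃ L ≤ D, (pumpkinChain D hD k hk m hm).PathOfLength x y L := by
  obtain ⟨e, s, rfl⟩ := exists_edgePoint D hD k hk m hm x
  obtain ⟨f, t, rfl⟩ := exists_edgePoint D hD k hk m hm y
  rcases lt_trichotomy e.1 f.1 with h | h | h
  · exact exists_path_of_lt D hD k hk m hm e f s t h
  · have hk' : (1 : ℝ) ≤ k := Nat.one_le_cast.2 hk
    have hle : D / k ≤ D := div_le_self hD.le hk'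
    have hsrc : (pumpkinChain D hD k hk m hm).src e = (pumpkinChain D hD k hk m hm).src f :=
      congrArg Fin.castSucc h
    have htgt : (pumpkinChain D hD k hk m hm).tgt e = (pumpkinChain D hD k hk m hm).tgt f :=
      congrArg Fin.succ h
    rcases le_total (s.1 + t.1) (D / k) with hst | hst
    · have h1 := (pathOfLength_from_src e s).symm
      rw [hsrc] at h1
      exact ⟨_, hst.trans hle, h1.concat (pathOfLength_from_src f t)⟩
    · have h1 := pathOfLength_to_tgt e s
      rw [htgt] at h1
      refine ⟨_, ?_, h1.concat (pathOfLength_to_tgt f t).symm⟩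
      change (D / k - s.1) + (D / k - t.1) ≤ D
      linarith
  · obtain ⟨L, hL, hp⟩ := exists_path_of_lt D hD k hk m hm f e t s h
    exact ⟨L, hL, hp.symm⟩

theorem pumpkinChain_diam : (pumpkinChain D hD k hk m hm).diam = D := by
  have hbdd : ∀ x y, BddBelow {L | (pumpkinChain D hD k hk m hm).PathOfLength x y L} :=
    fun x y => ⟨0, fun L hL => hL.nonneg⟩
  have hle : ∀ x y, (pumpkinChain D hD k hk m hm).dist x y ≤ D := by
    intro x y
    obtain ⟨L, hL, hp⟩ := exists_path_le D hD k hk m hm x y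
    exact (csInf_le (hbdd x y) hp).trans hL
  refine IsGreatest.csSup_eq ⟨⟨(pumpkinChain D hD k hk m hm).vertexPoint (0 : Fin (k + 1)),
    (pumpkinChain D hD k hk m hm).vertexPoint (Fin.last k), le_antisymm ?_ (hle _ _)⟩, ?_⟩
  · obtain ⟨L, -, hp⟩ := exists_path_le D hD k hk m hm
      ((pumpkinChain D hD k hk m hm).vertexPoint (0 : Fin (k + 1)))
      ((pumpkinChain D hD k hk m hm).vertexPoint (Fin.last k))
    refine le_csInf ⟨L, hp⟩ fun L hL => ?_
    refine le_trans (le_of_eq ?_) (abs_pumpkinHeight_sub_le D hD k hk m hm hL)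
    change D = |((0 : Fin (k + 1)).val : ℝ) * (D / k) - ((Fin.last k).val : ℝ) * (D / k)|
    have hk' : (k : ℝ) ≠ 0 := Nat.cast_ne_zero.2 hk.ne'
    rw [Fin.val_zero, Fin.val_last, Nat.cast_zero, zero_mul, zero_sub, abs_neg,
      mul_div_cancel₀ _ hk', abs_of_pos hD]
  · rintro _ ⟨x, y, rfl⟩
    exact hle x y

end PumpkinChain

end MetricGraph

/-! ### Solutions on a single edge -/

/-- `f` is `C¹` on `[0, ℓ]` with derivative `f'`, and `-f'' = μ f` inside. -/
structure IsOscillation (ℓ μ : ℝ) (f f' : ℝ → ℝ) : Prop where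
  deriv : ∀ x ∈ Icc 0 ℓ, HasDerivWithinAt f (f' x) (Icc 0 ℓ) x
  deriv_cont : ContinuousOn f' (Icc 0 ℓ)
  equation : ∀ x ∈ Ioo 0 ℓ, HasDerivAt f' (-(μ * f x)) x

theorem eq_of_hasDerivAt_zero {g : ℝ → ℝ} {ℓ : ℝ} (hg : ContinuousOn g (Icc 0 ℓ))
    (hd : ∀ x ∈ Ioo 0 ℓ, HasDerivAt g 0 x) {x : ℝ} (hx : x ∈ Icc 0 ℓ) : g x = g 0 := by
  have := intervalIntegral.integral_eq_sub_of_hasDerivAt_of_le hx.1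
    (hg.mono (Icc_subset_Icc_right hx.2)) (fun t ht => hd t ⟨ht.1, ht.2.trans_le hx.2⟩)
    intervalIntegrable_const
  rw [intervalIntegral.integral_zero] at this
  linarith

namespace IsOscillation

variable {ℓ μ : ℝ} {f f' g g' : ℝ → ℝ}

theorem continuousOn (h : IsOscillation ℓ μ f f') : ContinuousOn f (Icc 0 ℓ) :=
  fun x hx => (h.deriv x hx).continuousWithinAt

theorem hasDerivAt (h : IsOscillation ℓ μ f f') {x : ℝ} (hx : x ∈ Ioo 0 ℓ) :
    HasDerivAt f (f' x) x :=
  (h.deriv x (Ioo_subset_Icc_self hx)).hasDerivAt (Icc_mem_nhds hx.1 hx.2)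

theorem linear_comb (h : IsOscillation ℓ μ f f') (h₂ : IsOscillation ℓ μ g g') (c : ℝ) :
    IsOscillation ℓ μ (fun x => f x - c * g x) (fun x => f' x - c * g' x) where
  deriv x hx := (h.deriv x hx).sub ((h₂.deriv x hx).const_mul c)
  deriv_cont := h.deriv_cont.sub (continuousOn_const.mul h₂.deriv_cont)
  equation x hx := ((h.equation x hx).sub ((h₂.equation x hx).const_mul c)).congr_deriv (by ring)

theorem energy_eq (h : IsOscillation ℓ μ f f') {x : ℝ} (hx : x ∈ Icc 0 ℓ) :
    μ * f x ^ 2 + f' x ^ 2 = μ * f 0 ^ 2 + f' 0 ^ 2 := by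
  refine eq_of_hasDerivAt_zero (g := fun x => μ * f x ^ 2 + f' x ^ 2)
    ((continuousOn_const.mul (h.continuousOn.pow 2)).add (h.deriv_cont.pow 2)) (fun t ht => ?_) hx
  refine ((((h.hasDerivAt ht).pow 2).const_mul μ).add ((h.equation t ht).pow 2)).congr_deriv ?_
  simp only [Nat.cast_ofNat]
  ring

theorem eq_zero_of_energy (hμ : 0 < μ) {a b : ℝ} (h : μ * a ^ 2 + b ^ 2 = 0) : a = 0 ∧ b = 0 := by
  have h1 : 0 ≤ μ * a ^ 2 := by positivity
  have h2 : μ * a ^ 2 = 0 := by linarith [sq_nonneg b]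
  exact ⟨pow_eq_zero_iff two_ne_zero |>.1 ((mul_eq_zero.1 h2).resolve_left hμ.ne'),
    pow_eq_zero_iff two_ne_zero |>.1 (by linarith)⟩

theorem eq_zero_of_initial (h : IsOscillation ℓ μ f f') (hμ : 0 < μ) (h0 : f 0 = 0)
    (h0' : f' 0 = 0) {x : ℝ} (hx : x ∈ Icc 0 ℓ) : f x = 0 ∧ f' x = 0 :=
  eq_zero_of_energy hμ (by rw [h.energy_eq hx, h0, h0']; ring)

/-- With θ = √μ, the Wronskian of f and sin(θx) is constant. Comparing the ends gives f'(ℓ) sin(θℓ)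
= 0, where 0 < θℓ < π. Conservation of μ f² + f'² then carries f'(ℓ) = 0 back to 0. -/
theorem deriv_zero_of_dirichlet (h : IsOscillation ℓ μ f f') (hℓ : 0 < ℓ) (hμ : 0 < μ)
    (hlt : μ < (Real.pi / ℓ) ^ 2) (h0 : f 0 = 0) (h1 : f ℓ = 0) : f' 0 = 0 := by
  have hℓm : ℓ ∈ Icc 0 ℓ := ⟨hℓ.le, le_rfl⟩
  set θ := Real.sqrt μ
  have hθ : θ ^ 2 = μ := Real.sq_sqrt hμ.le
  have hθ0 : 0 < θ := Real.sqrt_pos.2 hμ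
  have hθlt : θ * ℓ < Real.pi := by
    rw [← lt_div_iff₀ hℓ]
    exact lt_of_pow_lt_pow_left₀ 2 (by positivity) (hθ.trans_lt hlt)
  have key := eq_of_hasDerivAt_zero
    (g := fun x => f x * (θ * Real.cos (θ * x)) - f' x * Real.sin (θ * x)) (ℓ := ℓ)
    ((h.continuousOn.mul (by fun_prop)).sub (h.deriv_cont.mul (by fun_prop))) (fun t ht => by
      have hl : HasDerivAt (fun x : ℝ => θ * x) θ t := by
        simpa using (hasDerivAt_id t).const_mul θ
      refine (((h.hasDerivAt ht).mul (hl.cos.const_mul θ)).sub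
        ((h.equation t ht).mul hl.sin)).congr_deriv ?_
      rw [← hθ]; ring) hℓm
  simp only [h0, h1, zero_mul, mul_zero, Real.sin_zero, sub_zero, zero_sub, neg_eq_zero] at key
  have hsin : Real.sin (θ * ℓ) ≠ 0 := (Real.sin_pos_of_pos_of_lt_pi (mul_pos hθ0 hℓ) hθlt).ne'
  have h2 := h.energy_eq hℓm
  rw [h0, h1, (mul_eq_zero.1 key).resolve_right hsin] at h2
  exact (eq_zero_of_energy (a := 0) hμ (by linarith)).2

end IsOscillation

theorem IsWeight.hasDerivWithinAt_volterra_segment {φ g : ℝ → ℝ} (hφ : IsWeight φ)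
    (hg : Continuous g) {a ℓ c : ℝ} (hc : ∀ t ∈ Ioo 0 ℓ, φ (a + t) = c) {s : ℝ}
    (hs : s ∈ Icc 0 ℓ) :
    HasDerivWithinAt (fun s => volterra φ g (a + s)) (c * g (a + s)) (Icc 0 ℓ) s := by
  have hga : Continuous fun t => c * g (a + t) := by fun_prop
  have key : ∀ s ∈ Icc 0 ℓ, volterra φ g (a + s) =
      volterra φ g a + ∫ t in (0 : ℝ)..s, c * g (a + t) := by
    intro s hs
    have h1 : ∫ t in (0 : ℝ)..s, c * g (a + t) = ∫ t in (0 : ℝ)..s, φ (a + t) * g (a + t) :=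
      intervalIntegral.integral_congr_Ioo_of_le hs.1 fun t ht => by
        simp only [hc t ⟨ht.1, ht.2.trans_le hs.2⟩]
    rw [h1, intervalIntegral.integral_comp_add_left (fun t => φ t * g t) a, add_zero]
    exact (intervalIntegral.integral_add_adjacent_intervals (hφ.intervalIntegrable_mul hg _ _)
      (hφ.intervalIntegrable_mul hg _ _)).symm
  exact (((hga.integral_hasStrictDerivAt 0 s).hasDerivAt.const_add _).hasDerivWithinAt).congr
    key (key s hs)

theorem IsSol.isOscillation_segment {D μ : ℝ} {w u Z : ℝ → ℝ} (hw : IsWeight w)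
    (h : IsSol D w μ u Z) {a ℓ c : ℝ} (ha : 0 ≤ a) (hℓ : a + ℓ ≤ D) (hc0 : c ≠ 0)
    (hc : ∀ t ∈ Ioo 0 ℓ, w (a + t) = c) :
    IsOscillation ℓ μ (fun s => u (a + s)) (fun s => -(μ * (c⁻¹ * Z (a + s)))) := by
  have hmem : ∀ s ∈ Icc 0 ℓ, a + s ∈ Icc 0 D := fun s hs =>
    ⟨add_nonneg ha hs.1, (add_le_add_right hs.2 a).trans hℓ⟩
  have := h.cont_Z
  refine ⟨fun s hs => ?_, by fun_prop, fun s hs => ?_⟩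
  · have h1 := hw.inv.hasDerivWithinAt_volterra_segment h.cont_Z (c := c⁻¹)
      (fun t ht => by rw [hc t ht]) hs
    exact ((h1.const_mul μ).const_sub (u 0)).congr (fun t ht => h.eq_u _ (hmem t ht))
      (h.eq_u _ (hmem s hs))
  · have hs' := Ioo_subset_Icc_self hs
    have h1 := (hw.hasDerivWithinAt_volterra_segment h.cont_u hc hs').congr
      (fun t ht => h.eq_Z _ (hmem t ht)) (h.eq_Z _ (hmem s hs'))
    refine ((((h1.hasDerivAt (Icc_mem_nhds hs.1 hs.2)).const_mul c⁻¹).const_mul μ).neg).congr_deriv ?_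
    rw [inv_mul_cancel_left₀ hc0]

/-! ### Spectrum of a pumpkin chain -/

/-- The weight on `[0, D]` given by the number of edges of a pumpkin chain. -/
noncomputable def chainWeight (D : ℝ) (k : ℕ) (m : ℕ → ℕ) (x : ℝ) : ℝ := m ⌊x / (D / k)⌋₊

theorem chainWeight_segment {D : ℝ} (hD : 0 < D) {k : ℕ} (hk : 0 < k) (m : ℕ → ℕ) (i : ℕ) {t : ℝ}
    (ht : t ∈ Ico 0 (D / k)) : chainWeight D k m (i * (D / k) + t) = m i := by
  have hℓ : 0 < D / k := div_pos hD (Nat.cast_pos.2 hk)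
  have : ⌊(i * (D / k) + t) / (D / k)⌋₊ = i := by
    rw [Nat.floor_eq_iff (div_nonneg (by have := ht.1; positivity) hℓ.le), le_div_iff₀ hℓ,
      div_lt_iff₀ hℓ]
    exact ⟨by linarith [ht.1], by linarith [ht.2]⟩
  rw [chainWeight, this]

theorem isWeight_chainWeight {D : ℝ} (hD : 0 < D) {k : ℕ} (hk : 0 < k) {m : ℕ → ℕ}
    (hm : ∀ i, 0 < m i) {M : ℕ} (hM : ∀ i, m i ≤ M) : IsWeight (chainWeight D k m) where
  measurable := by
    have h1 : Measurable fun n : ℕ => (m n : ℝ) := measurable_from_top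
    exact h1.comp (Nat.measurable_floor.comp (measurable_id.div_const _))
  right_cont x := by
    have hℓ : 0 < D / k := div_pos hD (Nat.cast_pos.2 hk)
    have h1 : Tendsto (fun y => y / (D / k)) (𝓝[≥] x) (𝓝[≥] (x / (D / k))) :=
      tendsto_nhdsWithin_of_tendsto_nhds_of_eventually_within _
        ((continuous_id.div_const _).continuousWithinAt)
        (eventually_mem_nhdsWithin.mono fun y hy => div_le_div_of_nonneg_right hy hℓ.le)
    -- The floor, and with it the step weight, is locally constant to the right.
    have h2 := (tendsto_floor_right_pure_floor (x / (D / k))).comp h1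
    have h3 : Tendsto (chainWeight D k m) (𝓝[≥] x) (pure (chainWeight D k m x)) := by
      rw [tendsto_pure] at h2 ⊢
      filter_upwards [h2] with y hy
      simp only [chainWeight, ← Int.floor_toNat]
      rw [← hy]; rfl
    exact h3.mono_right (pure_le_nhds _)
  lower := ⟨1, one_pos, fun x => Nat.one_le_cast.2 (hm _)⟩
  upper := ⟨M, fun x => Nat.cast_le.2 (hM _)⟩

namespace MetricGraph

section PumpkinSpectrum

variable (D : ℝ) (hD : 0 < D) (k : ℕ) (hk : 0 < k) (m : ℕ → ℕ) (hm : ∀ i, 0 < m i)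

theorem pumpkinChain_kirchhoff_sum [DecidableEq (Fin (k + 1))] (a b : (Σ i : Fin k, Fin (m i)) → ℝ) (v : Fin (k + 1)) :
    ∑ e : Σ i : Fin k, Fin (m i), ((if e.1.castSucc = v then a e else 0)
      + (if e.1.succ = v then -b e else 0)) =
    (if h : v.val < k then ∑ j : Fin (m v.val), a ⟨⟨v.val, h⟩, j⟩ else 0)
      - (if h : 0 < v.val then ∑ j : Fin (m (v.val - 1)), b ⟨⟨v.val - 1, by omega⟩, j⟩ else 0) := by
  rw [Finset.sum_add_distrib, Fintype.sum_sigma, Fintype.sum_sigma, sub_eq_add_neg]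
  congr 1
  · split_ifs with h
    · rw [Finset.sum_eq_single (⟨v.val, h⟩ : Fin k)]
      · exact Finset.sum_congr rfl fun j _ => if_pos (Fin.ext rfl)
      · intro i _ hi
        refine Finset.sum_eq_zero fun j _ => if_neg fun he => hi (Fin.ext ?_)
        have h1 := congrArg Fin.val he
        exact h1
      · simp
    · refine Finset.sum_eq_zero fun i _ => Finset.sum_eq_zero fun j _ => if_neg fun he => h ?_
      have h1 := congrArg Fin.val he
      rw [Fin.val_castSucc] at h1
      have := i.2
      omega
  · split_ifs with h
    · rw [Finset.sum_eq_single (⟨v.val - 1, by omega⟩ : Fin k), ← Finset.sum_neg_distrib]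
      · exact Finset.sum_congr rfl fun j _ => if_pos (Fin.ext (by simp only [Fin.val_succ]; omega))
      · intro i _ hi
        refine Finset.sum_eq_zero fun j _ => if_neg fun he => hi (Fin.ext ?_)
        have h1 : i.val + 1 = v.val := congrArg Fin.val he
        change i.val = v.val - 1
        omega
      · simp
    · rw [neg_zero]
      refine Finset.sum_eq_zero fun i _ => Finset.sum_eq_zero fun j _ => if_neg fun he => h ?_
      have h1 := congrArg Fin.val he
      rw [Fin.val_succ] at h1
      omega

variable {D k m} {hD hk hm} {M : ℕ}

open Classical in
theorem pumpkinChain_kirchhoff {μ : ℝ} {u u' : (Σ i : Fin k, Fin (m i)) → ℝ → ℝ}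
    {c : Fin (k + 1) → ℝ} (h : (pumpkinChain D hD k hk m hm).IsEigenfunction μ u u' c)
    (v : Fin (k + 1)) :
    (if h : v.val < k then ∑ j : Fin (m v.val), u' ⟨⟨v.val, h⟩, j⟩ 0 else 0) =
      if h : 0 < v.val then ∑ j : Fin (m (v.val - 1)), u' ⟨⟨v.val - 1, by omega⟩, j⟩ (D / k)
      else 0 := by
  have h1 := @pumpkinChain_kirchhoff_sum k m (fun a b => propDecidable (a = b)) (fun e => u' e 0) (fun e => u' e (D / k)) v
  have h2 := h.kirchhoff v
  exact sub_eq_zero.1 (h1.symm.trans h2)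

theorem isOscillation_chain (hD : 0 < D) (hk : 0 < k) (hm : ∀ i, 0 < m i)
    (hw : IsWeight (chainWeight D k m)) (μ : ℝ) (i : ℕ) (hi : i < k) :
    IsOscillation (D / k) μ (fun s => shootU D (chainWeight D k m) μ (i * (D / k) + s))
      (fun s => -(μ * ((m i : ℝ)⁻¹ * shootZ D (chainWeight D k m) μ (i * (D / k) + s)))) := by
  have hk' : (0 : ℝ) < k := Nat.cast_pos.2 hk
  have hℓ : 0 < D / k := div_pos hD hk'
  refine (isSol_shoot hw hD.le μ).isOscillation_segment hw (by positivity) ?_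
    (Nat.cast_ne_zero.2 (hm i).ne')
    fun t ht => chainWeight_segment hD hk m i (Ioo_subset_Ico_self ht)
  have h1 : ((i : ℝ) + 1) * (D / k) ≤ k * (D / k) := by
    have : (i : ℝ) + 1 ≤ k := by exact_mod_cast hi
    gcongr
  rw [mul_div_cancel₀ _ hk'.ne'] at h1
  linarith

open Classical in
-- The flux -μ Z is shared equally among the parallel edges. Its continuity is the Kirchhoff
-- condition at inner vertices, and Z(0) = Z(D) = 0 is the condition at the ends.
theorem mem_positiveEigenvalues_of_mem_weightEigenvalues (hw : IsWeight (chainWeight D k m))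
    {μ : ℝ} (hμ : μ ∈ weightEigenvalues D (chainWeight D k m)) :
    μ ∈ (pumpkinChain D hD k hk m hm).positiveEigenvalues := by
  have hk' : (0 : ℝ) < k := Nat.cast_pos.2 hk
  have hℓ : 0 < D / k := div_pos hD hk'
  have hs := isSol_shoot hw hD.le μ
  have hosc := fun i hi => isOscillation_chain hD hk hm hw μ i hi
  set U := shootU D (chainWeight D k m) μ with hU
  set Z := shootZ D (chainWeight D k m) μ
  refine ⟨hμ.1, fun (e : Σ i : Fin k, Fin (m i)) s => U (e.1.val * (D / k) + s),
    fun (e : Σ i : Fin k, Fin (m i)) s =>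
      -(μ * ((m e.1.val : ℝ)⁻¹ * Z (e.1.val * (D / k) + s))),
    fun v : Fin (k + 1) => U (v.val * (D / k)), ?_, ?_, ?_, ?_, ?_, ?_, ?_⟩
  · refine ⟨(⟨⟨0, hk⟩, ⟨0, hm _⟩⟩ : Σ i : Fin k, Fin (m i)), 0, ⟨le_rfl, hℓ.le⟩, ?_⟩
    simp only [Nat.cast_zero, zero_mul, add_zero]
    rw [hU, shootU_zero hD.le]
    exact one_ne_zero
  · exact fun (e : Σ i : Fin k, Fin (m i)) => (hosc e.1.val e.1.2).deriv
  · exact fun (e : Σ i : Fin k, Fin (m i)) => (hosc e.1.val e.1.2).deriv_cont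
  · exact fun (e : Σ i : Fin k, Fin (m i)) => (hosc e.1.val e.1.2).equation
  · exact fun (e : Σ i : Fin k, Fin (m i)) => congrArg U (add_zero _)
  · intro (e : Σ i : Fin k, Fin (m i))
    refine congrArg U ?_
    change (e.1.val : ℝ) * (D / k) + D / k = ((e.1.succ).val : ℝ) * (D / k)
    rw [Fin.val_succ]; push_cast; ring
  · intro (v : Fin (k + 1))
    refine (@pumpkinChain_kirchhoff_sum k m (fun a b => propDecidable (a = b)) _ _ v).trans ?_
    have hv := v.2
    have hsum : ∀ (i : ℕ) (x : ℝ), ∑ j : Fin (m i), -(μ * ((m i : ℝ)⁻¹ * Z x)) = -(μ * Z x) := by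
      intro i x
      have := (Nat.cast_pos (α := ℝ)).2 (hm i)
      rw [Finset.sum_const, Finset.card_univ, Fintype.card_fin, nsmul_eq_mul]
      field_simp
    have h1 : (if h : v.val < k then ∑ j : Fin (m v.val),
        -(μ * ((m v.val : ℝ)⁻¹ * Z (v.val * (D / k) + 0))) else 0) = -(μ * Z (v.val * (D / k))) := by
      split_ifs with h
      · rw [hsum, add_zero]
      · have : v.val = k := by omega
        rw [this, mul_div_cancel₀ _ hk'.ne', show Z D = 0 from hμ.2, mul_zero, neg_zero]
    have h2 : (if h : 0 < v.val then ∑ j : Fin (m (v.val - 1)),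
        -(μ * ((m (v.val - 1) : ℝ)⁻¹ * Z ((v.val - 1 : ℕ) * (D / k) + D / k))) else 0)
        = -(μ * Z (v.val * (D / k))) := by
      split_ifs with h
      · rw [hsum, Nat.cast_pred h]
        ring_nf
      · have : v.val = 0 := by omega
        rw [this, Nat.cast_zero, zero_mul, hs.Z_zero hD.le, mul_zero, neg_zero]
    exact sub_eq_zero.2 (h1.trans h2.symm)

/-- Below the Dirichlet threshold an eigenfunction agrees on parallel edges. Vertex value and total
flux then propagate from pumpkin to pumpkin as for a multiple of the shooting solution, and the
Kirchhoff condition at the last vertex yields Z(D) = 0. -/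
theorem mem_weightEigenvalues_of_mem_positiveEigenvalues (hw : IsWeight (chainWeight D k m))
    {μ : ℝ} (hμ : μ ∈ (pumpkinChain D hD k hk m hm).positiveEigenvalues)
    (hlt : μ < (Real.pi / (D / k)) ^ 2) : μ ∈ weightEigenvalues D (chainWeight D k m) := by
  have hk' : (0 : ℝ) < k := Nat.cast_pos.2 hk
  have hℓ : 0 < D / k := div_pos hD hk'
  obtain ⟨hμ0, u, u', c, h⟩ := hμ
  have hs := isSol_shoot hw hD.le μ
  have hosc := fun i hi => isOscillation_chain hD hk hm hw μ i hi
  set U := shootU D (chainWeight D k m) μ with hU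
  set Z := shootZ D (chainWeight D k m) μ
  replace h : (pumpkinChain D hD k hk m hm).IsEigenfunction μ u u' c := h
  have hu : ∀ e : Σ i : Fin k, Fin (m i), IsOscillation (D / k) μ (u e) (u' e) :=
    fun e => ⟨h.deriv e, h.deriv_cont e, h.equation e⟩
  set c' : ℕ → ℝ := fun i => if hi : i < k + 1 then c (⟨i, hi⟩ : Fin (k + 1)) else 0 with hc'
  have hsrc : ∀ e : Σ i : Fin k, Fin (m i), u e 0 = c' e.1.val := by
    intro e
    simp only [hc', dif_pos (e.1.2.trans (Nat.lt_succ_self k))]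
    exact h.continuous_src e
  have htgt : ∀ e : Σ i : Fin k, Fin (m i), u e (D / k) = c' (e.1.val + 1) := by
    intro e
    simp only [hc', dif_pos (Nat.succ_lt_succ e.1.2)]
    exact h.continuous_tgt e
  have hmemℓ : D / k ∈ Icc 0 (D / k) := ⟨hℓ.le, le_rfl⟩
  have hedge : ∀ i (hi : i < k), c' i = c' 0 * U (i * (D / k)) →
      ∑ j : Fin (m i), u' (⟨⟨i, hi⟩, j⟩ : Σ i : Fin k, Fin (m i)) 0 =
        -(c' 0 * μ * Z (i * (D / k))) →
      ∀ j : Fin (m i), ∀ s ∈ Icc 0 (D / k),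
        u (⟨⟨i, hi⟩, j⟩ : Σ i : Fin k, Fin (m i)) s = c' 0 * U (i * (D / k) + s) ∧
        u' (⟨⟨i, hi⟩, j⟩ : Σ i : Fin k, Fin (m i)) s =
          c' 0 * -(μ * ((m i : ℝ)⁻¹ * Z (i * (D / k) + s))) := by
    intro i hi hci hsum j s hs
    have hmi : (m i : ℝ) ≠ 0 := Nat.cast_ne_zero.2 (hm i).ne'
    -- The difference of two parallel edges vanishes at both ends, so their initial slopes coincide;
    -- each is the total flux divided by m i.
    have heq : ∀ j' : Fin (m i), u' (⟨⟨i, hi⟩, j'⟩ : Σ i : Fin k, Fin (m i)) 0 =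
        u' (⟨⟨i, hi⟩, j⟩ : Σ i : Fin k, Fin (m i)) 0 := by
      intro j'
      have := ((hu ⟨⟨i, hi⟩, j'⟩).linear_comb (hu ⟨⟨i, hi⟩, j⟩) 1).deriv_zero_of_dirichlet hℓ hμ0 hlt
        (by rw [hsrc, hsrc]; simp) (by rw [htgt, htgt]; simp)
      linarith
    rw [Finset.sum_congr rfl fun j' _ => heq j', Finset.sum_const, Finset.card_univ,
      Fintype.card_fin, nsmul_eq_mul] at hsum
    have h1 := ((hu ⟨⟨i, hi⟩, j⟩).linear_comb (hosc i hi) (c' 0)).eq_zero_of_initial hμ0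
      (by rw [hsrc, add_zero]; exact sub_eq_zero.2 hci)
      (by
        have h2 : u' (⟨⟨i, hi⟩, j⟩ : Σ i : Fin k, Fin (m i)) 0 =
            -(c' 0 * μ * Z (i * (D / k))) / m i := by
          rw [eq_div_iff hmi, mul_comm]; exact hsum
        rw [add_zero, h2]
        ring) hs
    exact ⟨by linarith [h1.1], by linarith [h1.2]⟩
  have hflux : ∀ i (hi : i < k), (∀ j : Fin (m i), u' (⟨⟨i, hi⟩, j⟩ : Σ i : Fin k, Fin (m i)) (D / k)
      = c' 0 * -(μ * ((m i : ℝ)⁻¹ * Z (i * (D / k) + D / k)))) →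
      ∑ j : Fin (m i), u' (⟨⟨i, hi⟩, j⟩ : Σ i : Fin k, Fin (m i)) (D / k) =
        -(c' 0 * μ * Z ((i + 1 : ℕ) * (D / k))) := by
    intro i hi hj
    have hmi : (m i : ℝ) ≠ 0 := Nat.cast_ne_zero.2 (hm i).ne'
    rw [Finset.sum_congr rfl fun j _ => hj j, Finset.sum_const, Finset.card_univ,
      Fintype.card_fin, nsmul_eq_mul]
    have e : (i : ℝ) * (D / k) + D / k = (i + 1 : ℕ) * (D / k) := by push_cast; ring
    rw [e]
    field_simp
  have hind : ∀ i (hi : i < k), c' i = c' 0 * U (i * (D / k)) ∧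
      ∑ j : Fin (m i), u' (⟨⟨i, hi⟩, j⟩ : Σ i : Fin k, Fin (m i)) 0 =
        -(c' 0 * μ * Z (i * (D / k))) := by
    intro i
    induction i with
    | zero =>
      intro hi
      rw [Nat.cast_zero, zero_mul, hs.Z_zero hD.le, hU, shootU_zero hD.le]
      have := pumpkinChain_kirchhoff h ⟨0, by omega⟩
      rw [dif_pos hi, dif_neg (lt_irrefl 0)] at this
      exact ⟨(mul_one _).symm, by rw [this]; simp⟩
    | succ i ih =>
      intro hi
      have hi' : i < k := by omega
      obtain ⟨h1, h2⟩ := ih hi'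
      have h3 := hedge i hi' h1 h2
      have h4 := pumpkinChain_kirchhoff h ⟨i + 1, by omega⟩
      rw [dif_pos hi, dif_pos (Nat.succ_pos i)] at h4
      refine ⟨?_, h4.trans (hflux i hi' fun j => (h3 j _ hmemℓ).2)⟩
      have h5 := (h3 ⟨0, hm i⟩ _ hmemℓ).1
      rw [htgt] at h5
      rw [h5]
      push_cast
      ring_nf
  have hc0 : c' 0 ≠ 0 := by
    intro h0
    obtain ⟨e, s, hs', hne⟩ := h.nonzero
    obtain ⟨h1, h2⟩ := hind e.1.val e.1.2
    have h3 := (hedge e.1.val e.1.2 h1 h2 e.2 s hs').1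
    rw [h0, zero_mul] at h3
    exact hne h3
  have hlast := pumpkinChain_kirchhoff h (Fin.last k)
  rw [dif_neg (show ¬(Fin.last k).val < k from lt_irrefl k),
    dif_pos (show 0 < (Fin.last k).val from hk)] at hlast
  have hk1 : k - 1 < k := by omega
  obtain ⟨h1, h2⟩ := hind (k - 1) hk1
  have h3 := hflux (k - 1) hk1 fun j => (hedge (k - 1) hk1 h1 h2 j _ hmemℓ).2
  have h4 := hlast.trans h3
  rw [Nat.sub_add_cancel hk, mul_div_cancel₀ _ hk'.ne'] at h4
  refine ⟨hμ0, ?_⟩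
  have h5 : c' 0 * μ * Z D = 0 := by linarith
  exact (mul_eq_zero.1 h5).resolve_left (mul_ne_zero hc0 hμ0.ne')

theorem pumpkinChain_spectralGap (hM : ∀ i, m i ≤ M)
    (hlt : sInf (weightEigenvalues D (chainWeight D k m)) < (Real.pi / (D / k)) ^ 2) :
    IsLeast (pumpkinChain D hD k hk m hm).positiveEigenvalues
        (pumpkinChain D hD k hk m hm).spectralGap ∧
      (pumpkinChain D hD k hk m hm).spectralGap =
        sInf (weightEigenvalues D (chainWeight D k m)) := by
  have hw := isWeight_chainWeight hD hk hm hM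
  have hl := weightEigenvalues_isLeast hw hD (weightEigenvalues_nonempty hw hD)
  have h : IsLeast (pumpkinChain D hD k hk m hm).positiveEigenvalues
      (sInf (weightEigenvalues D (chainWeight D k m))) := by
    refine ⟨mem_positiveEigenvalues_of_mem_weightEigenvalues hw hl.1, fun μ hμ => ?_⟩
    -- Eigenvalues beyond the Dirichlet threshold need no description: they already exceed the
    -- claimed minimum.
    rcases lt_or_ge μ ((Real.pi / (D / k)) ^ 2) with h | h
    · exact hl.2 (mem_weightEigenvalues_of_mem_positiveEigenvalues hw hμ h)
    · exact hlt.le.trans h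
  have he : (pumpkinChain D hD k hk m hm).spectralGap =
      sInf (weightEigenvalues D (chainWeight D k m)) := h.csInf_eq
  exact ⟨he ▸ h, he⟩

end PumpkinSpectrum

end MetricGraph

/-! ### Approximation by pumpkin chains -/

theorem exists_chainWeight_approx {D : ℝ} (hD : 0 < D) {ω : ℝ → ℝ}
    (hω : ContinuousOn ω (Icc 0 D)) (hpos : ∀ x ∈ Icc 0 D, 0 < ω x) {η s : ℝ} (hη : 0 < η)
    (hs : 0 < s) :
    ∃ (k : ℕ) (m : ℕ → ℕ) (M N : ℕ), 0 < k ∧ D / k < s ∧ (∀ i, 0 < m i ∧ m i ≤ M) ∧ 0 < N ∧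
      ∀ x ∈ Icc 0 D, N * (1 - η) * ω (clamp D x) ≤ chainWeight D k m x ∧
        chainWeight D k m x ≤ N * (1 + η) * ω (clamp D x) := by
  obtain ⟨a, A, ha, hb⟩ := exists_bounds_clamp hD.le hω hpos
  -- There are two errors: the oscillation of ω over one mesh interval, less than δ, and the
  -- rounding up, less than 1 < Nδ after scaling by N. Together they are at most 2Nδ = Nηa ≤ Nηω.
  set δ := a * η / 2 with hδ
  have hδ0 : 0 < δ := by positivity
  obtain ⟨r, hr, hur⟩ := Metric.uniformContinuousOn_iff.1
    (isCompact_Icc.uniformContinuousOn_of_continuous hω) δ hδ0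
  obtain ⟨k, hk⟩ := exists_nat_gt (D / min r s)
  have hrs : 0 < min r s := lt_min hr hs
  have hk0 : (0 : ℝ) < k := (div_pos hD hrs).trans hk
  have hDk : D / k < min r s := (div_lt_comm₀ hrs hk0).1 hk
  have hℓ : 0 < D / k := div_pos hD hk0
  obtain ⟨N, hN⟩ := exists_nat_gt δ⁻¹
  have hN0 : (0 : ℝ) < N := (inv_pos.2 hδ0).trans hN
  have hNδ : 1 < N * δ := by rwa [inv_lt_iff_one_lt_mul₀ hδ0] at hN
  refine ⟨k, fun i => ⌈N * ω (clamp D (i * (D / k)))⌉₊, ⌈N * A⌉₊, N, Nat.cast_pos.1 hk0,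
    hDk.trans_le (min_le_right _ _), fun i => ⟨?_, ?_⟩, Nat.cast_pos.1 hN0, fun x hx => ?_⟩
  · exact Nat.ceil_pos.2 (mul_pos hN0 (ha.trans_le (hb _).1))
  · exact Nat.ceil_le_ceil (mul_le_mul_of_nonneg_left (hb _).2 hN0.le)
  · have hq : 0 ≤ x / (D / k) := div_nonneg hx.1 hℓ.le
    set y := (⌊x / (D / k)⌋₊ : ℝ) * (D / k) with hy
    have hyx : y ≤ x := (le_div_iff₀ hℓ).1 (Nat.floor_le hq)
    have hxy : x < y + D / k := by
      have := (div_lt_iff₀ hℓ).1 (Nat.lt_floor_add_one (x / (D / k)))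
      linarith
    have hym : y ∈ Icc 0 D := ⟨by positivity, hyx.trans hx.2⟩
    have hclose := hur y hym x hx (by
      rw [Real.dist_eq, abs_sub_comm, abs_of_nonneg (sub_nonneg.2 hyx)]
      linarith [min_le_left r s])
    rw [Real.dist_eq, abs_lt] at hclose
    have hax : a ≤ ω x := by simpa only [clamp_of_mem hx] using (hb x).1
    have hy0 : 0 ≤ N * ω y := (mul_pos hN0 (hpos y hym)).le
    have h1 := Nat.le_ceil (N * ω y)
    have h2 := Nat.ceil_lt_add_one hy0
    have h3 : 2 * δ ≤ η * ω x := by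
      have := mul_le_mul_of_nonneg_left hax hη.le
      linarith
    have h4 : (N : ℝ) * (2 * δ) ≤ N * (η * ω x) := mul_le_mul_of_nonneg_left h3 hN0.le
    have h5 : N * (ω x - δ) ≤ N * ω y := mul_le_mul_of_nonneg_left (by linarith) hN0.le
    have h6 : N * ω y ≤ N * (ω x + δ) := mul_le_mul_of_nonneg_left (by linarith) hN0.le
    rw [chainWeight, ← hy, clamp_of_mem hym, clamp_of_mem hx]
    constructor <;> linarith

theorem exists_pumpkinChain_close {D : ℝ} (hD : 0 < D) {ω : ℝ → ℝ}
    (hω : ContinuousOn ω (Icc 0 D)) (hpos : ∀ x ∈ Icc 0 D, 0 < ω x) {ε : ℝ} (hε : 0 < ε) :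
    ∃ G : MetricGraph, (G.IsPumpkinChain ∧ G.diam = D ∧
        IsLeast G.positiveEigenvalues G.spectralGap) ∧
      |G.spectralGap - sInf (weightEigenvalues D fun x => ω (clamp D x))| < ε := by
  have hw₀ := isWeight_comp_clamp hD.le hω hpos
  have hl := weightEigenvalues_isLeast hw₀ hD (weightEigenvalues_nonempty hw₀ hD)
  set lam := sInf (weightEigenvalues D fun x => ω (clamp D x))
  have hlam : 0 < lam := hl.1.1
  -- For η ≤ 1/2 one has (1 + η)/(1 - η) ≤ 1 + 4η ≤ 3. So the gap is at most 3λ, and it differs from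
  -- λ by at most 12ηλ ≤ ε/2.
  set η := min (1 / 2) (ε / (24 * lam))
  have hη0 : 0 < η := lt_min (by norm_num) (by positivity)
  have hη1 : η ≤ 1 / 2 := min_le_left _ _
  have hη2 : 24 * (η * lam) ≤ ε := by
    have := (le_div_iff₀ (by positivity)).1 (min_le_right (1 / 2) (ε / (24 * lam)))
    linarith
  have hsq : 0 < Real.sqrt (3 * lam + 1) := Real.sqrt_pos.2 (by positivity)
  -- This mesh bound puts the Dirichlet threshold above 3λ + 1, hence above the gap.
  obtain ⟨k, m, M, N, hk, hs, hm, hN, happ⟩ := exists_chainWeight_approx hD hω hpos hη0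
    (div_pos Real.pi_pos hsq)
  have hk' : (0 : ℝ) < k := Nat.cast_pos.2 hk
  have hN' : (0 : ℝ) < N := Nat.cast_pos.2 hN
  have hw := isWeight_chainWeight hD hk (fun i => (hm i).1) (fun i => (hm i).2)
  have hκ : 0 < N * (1 - η) := mul_pos hN' (by linarith)
  have hρ : 0 < N * (1 + η) := by positivity
  have hq : N * (1 + η) / (N * (1 - η)) ≤ 1 + 4 * η := by
    rw [mul_div_mul_left _ _ hN'.ne', div_le_iff₀ (by linarith)]
    nlinarith
  have h1 := sInf_weightEigenvalues_le hw₀ hw hD hκ happ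
  -- With the roles exchanged the constants are inverted, but their ratio is the same.
  have h2 := sInf_weightEigenvalues_le hw hw₀ hD (inv_pos.2 hρ) (ρ := (N * (1 - η))⁻¹)
    fun x hx => ⟨by rw [inv_mul_le_iff₀ hρ]; exact (happ x hx).2,
      by rw [le_inv_mul_iff₀ hκ]; exact (happ x hx).1⟩
  rw [inv_div_inv] at h2
  set gap := sInf (weightEigenvalues D (chainWeight D k m))
  have hgap0 : 0 ≤ gap := Real.sInf_nonneg fun μ hμ => hμ.1.le
  replace h1 : gap ≤ (1 + 4 * η) * lam := h1.trans (mul_le_mul_of_nonneg_right hq hlam.le)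
  replace h2 : lam ≤ (1 + 4 * η) * gap := h2.trans (mul_le_mul_of_nonneg_right hq hgap0)
  have hηlam : 0 < η * lam := mul_pos hη0 hlam
  have hgap3 : gap ≤ 3 * lam := h1.trans (mul_le_mul_of_nonneg_right (by linarith) hlam.le)
  have hlt : gap < (Real.pi / (D / k)) ^ 2 := by
    have h3 : Real.sqrt (3 * lam + 1) < Real.pi / (D / k) :=
      (lt_div_comm₀ (div_pos hD hk') hsq).1 hs
    have h4 := pow_lt_pow_left₀ h3 hsq.le two_ne_zero
    rw [Real.sq_sqrt (by positivity)] at h4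
    linarith
  obtain ⟨h3, h4⟩ := MetricGraph.pumpkinChain_spectralGap (hD := hD) (hk := hk)
    (hm := fun i => (hm i).1) (fun i => (hm i).2) hlt
  refine ⟨_, ⟨MetricGraph.pumpkinChain_isPumpkinChain D hD k hk m _,
    MetricGraph.pumpkinChain_diam D hD k hk m _, h3⟩, ?_⟩
  rw [h4, abs_lt]
  have h5 : η * gap ≤ η * (3 * lam) := mul_le_mul_of_nonneg_left hgap3 hη0.le
  constructor <;> linarith

theorem mainTheorem7 (D : ℝ) (hD : 0 < D) (ω : ℝ → ℝ) (hω : ContDiffOn ℝ 1 ω (Set.Icc 0 D))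
    (hpos : ∀ x ∈ Set.Icc 0 D, 0 < ω x) :
    IsLeast (positiveNeumannEigenvalues D ω) (firstNeumannEigenvalue D ω) ∧
    ∃ G : ℕ → MetricGraph,
      (∀ n, (G n).IsPumpkinChain ∧ (G n).diam = D ∧
        IsLeast (G n).positiveEigenvalues (G n).spectralGap) ∧
      Filter.Tendsto (fun n => (G n).spectralGap) Filter.atTop
        (nhds (firstNeumannEigenvalue D ω)) := by
  have hc := hω.continuousOn
  have hw := isWeight_comp_clamp hD.le hc hpos
  rw [firstNeumannEigenvalue, positiveNeumannEigenvalues_eq hD hc hpos]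
  refine ⟨weightEigenvalues_isLeast hw hD (weightEigenvalues_nonempty hw hD), ?_⟩
  choose G hG hclose using fun n : ℕ =>
    exists_pumpkinChain_close hD hc hpos (Nat.one_div_pos_of_nat (α := ℝ) (n := n))
  refine ⟨G, hG, tendsto_iff_dist_tendsto_zero.2 ?_⟩
  exact squeeze_zero (fun _ => dist_nonneg) (fun n => (hclose n).le)
    tendsto_one_div_add_atTop_nhds_zero_nat
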